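/- Let $X$ and $Y$ be smooth projective varieties over $\mathbb{C}$, let $\pi\colon X\to Y$ be a finite surjective morphism over $\mathbb{C}$ whose degree $[\mathbb{C}(X):\mathbb{C}(Y)]$ is a prime number, let $M$ be a torsion-free coherent sheaf on $X$, let $V$ be a locally free sheaf of finite rank on $Y$, and let $\sigma\in H^0(X,\pi^*V)$. Let $\Phi\colon \pi_*M\to \pi_*M\otimes V$ be the induced Higgs field, that is, the pushforward by $\pi$ of the morphism $M\to M\otimes\pi^*V$, $m\mapsto m\otimes\sigma$, under the canonical isomorphism $\pi_*M\otimes V\cong\pi_*(M\otimes\pi^*V)$; in other words, $\Phi$ is the unique morphism whose composite with the canonical morphism $\pi_*M\otimes V\to\pi_*(M\otimes\pi^*V)$ is this pushforward. Let $p_V\colon\mathrm{Tot}(V)\to Y$ be the total space of $V$ and $\eta$ the tautological section of $p_V^*V$, and let $C_\Phi\subseteq \mathrm{Tot}(V)$ be the spectral cover, that is, the closed subscheme defined by the vanishing of $\det(\Phi-\eta\otimes\mathrm{id})\in H^0(\mathrm{Tot}(V),p_V^*\mathrm{Sym}^{n}V)$, $n=\mathrm{rank}\,\pi_*M$ (where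 $\pi_*M$ is not locally free, the determinant is computed over the generic point of $Y$; its coefficients are regular because $Y$ is normal). Then 1. $\Phi=\tau\otimes\mathrm{id}_{\pi_*M}$ for some $\tau\in H^0(Y,V)$, or 2. $X$ is the normalization of $C_\Phi$ over $Y$: there is a morphism $\nu\colon X\to C_\Phi$, compatible with the projections to $Y$, that exhibits the normal variety $X$ as the normalization of the (irreducible, possibly non-reduced) scheme $C_\Phi$, i.e. $\nu$ is integral, dominant, and induces an isomorphism of the residue fields at the generic points. -/

import Mathlib

open CategoryTheory Limits TopologicalSpace AlgebraicGeometry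
open scoped AlgebraicGeometry TensorProduct
universe u
noncomputable section
namespace HiggsCover

variable {X Y : Scheme.{u}}

/-- Restriction of sections of a sheaf of modules. -/
abbrev res (M : X.Modules) {U W : X.Opens} (h : W ≤ U) (s : Γ(M, U)) : Γ(M, W) :=
  M.presheaf.map (homOfLE h).op s

/-- A morphism of sheaves of modules from compatible linear maps on sections. -/
def homMk {M N : X.Modules} (f : ∀ U : X.Opens, Γ(M, U) →ₗ[Γ(X, U)] Γ(N, U))
    (hf : ∀ (U W : X.Opens) (h : W ≤ U) (s : Γ(M, U)), f W (res M h s) = res N h (f U s)) :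
    M ⟶ N :=
  (⟨{ app := fun U => ModuleCat.ofHom (X := M.val.obj U) (Y := N.val.obj U)
        { toFun := fun s => f U.unop s
          map_add' := fun s t => (f U.unop).map_add s t
          map_smul' := fun r s => (f U.unop).map_smul r s }
      naturality := by
        intro U W i
        ext s
        exact hf U.unop W.unop i.unop.le s }⟩ : SheafOfModules.Hom M N)

@[simp] lemma homMk_app {M N : X.Modules} (f : ∀ U : X.Opens, Γ(M, U) →ₗ[Γ(X, U)] Γ(N, U))
    (hf) (U : X.Opens) (s : Γ(M, U)) : (homMk f hf).app U s = f U s := rfl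

/-- The action of a morphism on sections over `U`, as a linear map. -/
def appL {M N : X.Modules} (f : M ⟶ N) (U : X.Opens) : Γ(M, U) →ₗ[Γ(X, U)] Γ(N, U) where
  toFun := f.app U
  map_add' := map_add (f.app U).hom
  map_smul' := f.app_smul

/-- The presheaf tensor product `W ↦ M(W) ⊗ N(W)`. -/
def preTensor (M N : X.Modules) : X.PresheafOfModules :=
  PresheafOfModules.Monoidal.tensorObj (R := X.presheaf) M.val N.val

/-- The tensor product of sheaves of modules. -/
def tensor (M N : X.Modules) : X.Modules :=
  (PresheafOfModules.sheafification (𝟙 X.ringCatSheaf.obj)).obj (preTensor M N)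

/-- The canonical map from the presheaf tensor product to its sheafification. -/
def toTensor (M N : X.Modules) : preTensor M N ⟶
    (PresheafOfModules.restrictScalars (𝟙 X.ringCatSheaf.obj)).obj (tensor M N).val :=
  PresheafOfModules.sheafificationHomEquiv (𝟙 X.ringCatSheaf.obj) (𝟙 (tensor M N))

/-- The linear map `M(U) ⊗ N(U) → (M ⊗ N)(U)`. -/
def tmulHom (M N : X.Modules) (U : X.Opens) :
    Γ(M, U) ⊗[Γ(X, U)] Γ(N, U) →ₗ[Γ(X, U)] Γ(tensor M N, U) where
  toFun t := ((toTensor M N).app (.op U)).hom t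
  map_add' s t := ((toTensor M N).app (.op U)).hom.map_add s t
  map_smul' a t := ((toTensor M N).app (.op U)).hom.map_smul a t

/-- The section `m ⊗ n` of `M ⊗ N`. -/
def tmul {M N : X.Modules} {U : X.Opens} (m : Γ(M, U)) (n : Γ(N, U)) : Γ(tensor M N, U) :=
  tmulHom M N U (m ⊗ₜ n)

section tmul

variable {M N P : X.Modules} {U W : X.Opens}

lemma tmul_add (m : Γ(M, U)) (n n' : Γ(N, U)) : tmul m (n + n') = tmul m n + tmul m n' := by
  simp only [tmul, TensorProduct.tmul_add, map_add]

lemma add_tmul (m m' : Γ(M, U)) (n : Γ(N, U)) : tmul (m + m') n = tmul m n + tmul m' n := by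
  simp only [tmul, TensorProduct.add_tmul, map_add]

lemma smul_tmul (a : Γ(X, U)) (m : Γ(M, U)) (n : Γ(N, U)) :
    tmul (a • m) n = a • tmul m n := by
  simp only [tmul, ← TensorProduct.smul_tmul', map_smul]

lemma tmul_smul (a : Γ(X, U)) (m : Γ(M, U)) (n : Γ(N, U)) :
    tmul m (a • n) = a • tmul m n := by
  simp only [tmul, TensorProduct.tmul_smul, map_smul]

lemma res_tmul (h : W ≤ U) (m : Γ(M, U)) (n : Γ(N, U)) :
    res (tensor M N) h (tmul m n) = tmul (res M h m) (res N h n) :=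
  (PresheafOfModules.naturality_apply (toTensor M N) (homOfLE h).op (m ⊗ₜ[Γ(X, U)] n)).symm

lemma preTensor_map_lift (β : ∀ U : X.Opens, Γ(M, U) →ₗ[Γ(X, U)] Γ(N, U) →ₗ[Γ(X, U)] Γ(P, U))
    (hβ : ∀ (U W : X.Opens) (h : W ≤ U) (m : Γ(M, U)) (n : Γ(N, U)),
      β W (res M h m) (res N h n) = res P h (β U m n)) {U W : X.Opens} (h : W ≤ U)
    (t : Γ(M, U) ⊗[Γ(X, U)] Γ(N, U)) :
    TensorProduct.lift (β W) (((preTensor M N).map (homOfLE h).op).hom t) =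
      res P h (TensorProduct.lift (β U) t) := by
  induction t using TensorProduct.induction_on with
  | zero =>
    rw [map_zero]
    refine Eq.trans ?_ (map_zero (P.presheaf.map (homOfLE h).op).hom).symm
    refine Eq.trans (congrArg _ (map_zero ((preTensor M N).map (homOfLE h).op).hom)) ?_
    exact map_zero (TensorProduct.lift (β W))
  | tmul m n => exact hβ U W h m n
  | add s t hs ht =>
    rw [map_add]
    refine Eq.trans ?_ (map_add (P.presheaf.map (homOfLE h).op).hom _ _).symm
    refine Eq.trans (congrArg _ (map_add ((preTensor M N).map (homOfLE h).op).hom s t)) ?_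
    refine Eq.trans (map_add (TensorProduct.lift (β W)) _ _) ?_
    exact congrArg₂ _ hs ht

/-- The morphism of presheaves given by a compatible family of bilinear maps. -/
def preTensorDesc (β : ∀ U : X.Opens, Γ(M, U) →ₗ[Γ(X, U)] Γ(N, U) →ₗ[Γ(X, U)] Γ(P, U))
    (hβ : ∀ (U W : X.Opens) (h : W ≤ U) (m : Γ(M, U)) (n : Γ(N, U)),
      β W (res M h m) (res N h n) = res P h (β U m n)) :
    preTensor M N ⟶ (PresheafOfModules.restrictScalars (𝟙 X.ringCatSheaf.obj)).obj P.val where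
  app U :=
    let f : (preTensor M N).obj U →ₗ[X.ringCatSheaf.obj.obj U] P.val.obj U :=
      { toFun := fun t => TensorProduct.lift (β U.unop) t
        map_add' := fun s t => (TensorProduct.lift (β U.unop)).map_add s t
        map_smul' := fun r s => (TensorProduct.lift (β U.unop)).map_smul r s }
    (ModuleCat.ofHom f : ModuleCat.of (X.ringCatSheaf.obj.obj U) ((preTensor M N).obj U) ⟶
      ModuleCat.of (X.ringCatSheaf.obj.obj U) (P.val.obj U))
  naturality i := by
    ext t
    exact preTensor_map_lift β hβ i.unop.le t

/-- A morphism out of `M ⊗ N` from a compatible family of bilinear maps on sections. -/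
def tensorDesc (β : ∀ U : X.Opens, Γ(M, U) →ₗ[Γ(X, U)] Γ(N, U) →ₗ[Γ(X, U)] Γ(P, U))
    (hβ : ∀ (U W : X.Opens) (h : W ≤ U) (m : Γ(M, U)) (n : Γ(N, U)),
      β W (res M h m) (res N h n) = res P h (β U m n)) : tensor M N ⟶ P :=
  (PresheafOfModules.sheafificationHomEquiv (𝟙 X.ringCatSheaf.obj) (P := preTensor M N)
      (F := P)).symm (preTensorDesc β hβ)

lemma homEquiv_tmul (f : tensor M N ⟶ P) (t : Γ(M, U) ⊗[Γ(X, U)] Γ(N, U)) :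
    f.app U (tmulHom M N U t) =
      ((PresheafOfModules.sheafificationHomEquiv (𝟙 X.ringCatSheaf.obj) (P := preTensor M N)
      (F := P) f).app (.op U)).hom t := by
  have := (PresheafOfModules.sheafificationAdjunction (𝟙 X.ringCatSheaf.obj)).homEquiv_naturality_right
    (𝟙 (tensor M N)) f
  exact (congr((($this).app (.op U)).hom t)).symm

@[simp] lemma tensorDesc_tmul (β : ∀ U : X.Opens, Γ(M, U) →ₗ[Γ(X, U)] Γ(N, U) →ₗ[Γ(X, U)] Γ(P, U))
    (hβ) (m : Γ(M, U)) (n : Γ(N, U)) : (tensorDesc β hβ).app U (tmul m n) = β U m n := by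
  unfold tmul
  rw [homEquiv_tmul, tensorDesc]
  have h := Equiv.apply_symm_apply (PresheafOfModules.sheafificationHomEquiv
    (𝟙 X.ringCatSheaf.obj) (P := preTensor M N) (F := P)) (preTensorDesc β hβ)
  have h' := congr(($h).app (.op U))
  refine Eq.trans (LinearMap.congr_fun congr(($h').hom) _) ?_
  change TensorProduct.lift (β U) (m ⊗ₜ[Γ(X, U)] n) = β U m n
  simp

lemma tensor_hom_ext {f g : tensor M N ⟶ P}
    (h : ∀ (U : X.Opens) (m : Γ(M, U)) (n : Γ(N, U)),
      f.app U (tmul m n) = g.app U (tmul m n)) : f = g := by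
  apply (PresheafOfModules.sheafificationHomEquiv (𝟙 X.ringCatSheaf.obj) (P := preTensor M N)
      (F := P)).injective
  ext U t
  refine (homEquiv_tmul f (U := U.unop) t).symm.trans (Eq.trans ?_ (homEquiv_tmul g (U := U.unop) t))
  have : appL f U.unop ∘ₗ tmulHom M N U.unop = appL g U.unop ∘ₗ tmulHom M N U.unop :=
    TensorProduct.ext' (h U.unop)
  exact LinearMap.congr_fun this t

end tmul


lemma res_res {M : X.Modules} {U W W' : X.Opens} (h : W ≤ U) (h' : W' ≤ W) (s : Γ(M, U)) :
    res M h' (res M h s) = res M (h'.trans h) s := by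
  have := M.presheaf.map_comp (homOfLE h).op (homOfLE h').op
  exact congr(($this).hom s).symm

lemma res_self {M : X.Modules} {U : X.Opens} (s : Γ(M, U)) : res M le_rfl s = s :=
  congr(($(M.presheaf.map_id (.op U))).hom s)

lemma app_res {M N : X.Modules} (f : M ⟶ N) {U W : X.Opens} (h : W ≤ U) (s : Γ(M, U)) :
    f.app W (res M h s) = res N h (f.app U s) :=
  congr(($(f.mapPresheaf.naturality (homOfLE h).op)).hom s)

/-- The morphism `M → M ⊗ N`, `m ↦ m ⊗ s`, given by a global section `s` of `N`. -/
def tensorSection (M : X.Modules) {N : X.Modules} (s : Γ(N, ⊤)) : M ⟶ tensor M N :=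
  homMk (fun U => { toFun := fun m => tmul m (res N le_top s)
                    map_add' := fun _ _ => add_tmul _ _ _
                    map_smul' := fun _ _ => smul_tmul _ _ _ })
    (fun U W h m => by
      refine Eq.trans ?_ (res_tmul h m (res N le_top s)).symm
      rw [res_res]; rfl)

/-- The pullback `π^* s` of a section. -/
def pullbackSection (π : X ⟶ Y) {V : Y.Modules} {U : Y.Opens} (s : Γ(V, U)) :
    Γ((Scheme.Modules.pullback π).obj V, π ⁻¹ᵁ U) :=
  ((Scheme.Modules.pullbackPushforwardAdjunction π).unit.app V).app U s

section
variable (π : X ⟶ Y) {V : Y.Modules} {U W : Y.Opens}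

lemma pullbackSection_add (s t : Γ(V, U)) :
    pullbackSection π (s + t) = pullbackSection π s + pullbackSection π t :=
  (appL ((Scheme.Modules.pullbackPushforwardAdjunction π).unit.app V) U).map_add s t

lemma pullbackSection_smul (a : Γ(Y, U)) (s : Γ(V, U)) :
    pullbackSection π (a • s) = π.app U a • pullbackSection π s :=
  (appL ((Scheme.Modules.pullbackPushforwardAdjunction π).unit.app V) U).map_smul a s

lemma pullbackSection_res (h : W ≤ U) (s : Γ(V, U)) :
    pullbackSection π (res V h s) = res _ (π.preimage_mono h) (pullbackSection π s) :=
  app_res ((Scheme.Modules.pullbackPushforwardAdjunction π).unit.app V) h s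

end

/-- The canonical morphism `π_* M ⊗ V → π_* (M ⊗ π^* V)`, `m ⊗ v ↦ m ⊗ π^* v`. -/
def projectionMap (π : X ⟶ Y) (M : X.Modules) (V : Y.Modules) :
    tensor ((Scheme.Modules.pushforward π).obj M) V ⟶
      (Scheme.Modules.pushforward π).obj (tensor M ((Scheme.Modules.pullback π).obj V)) :=
  tensorDesc
    (fun U => LinearMap.mk₂ Γ(Y, U)
      (fun (m : Γ((Scheme.Modules.pushforward π).obj M, U)) v =>
        (tmul (U := π ⁻¹ᵁ U) (M := M) m (pullbackSection π v) :
        Γ((Scheme.Modules.pushforward π).obj (tensor M ((Scheme.Modules.pullback π).obj V)), U)))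
      (fun _ _ _ => add_tmul _ _ _)
      (fun a m v => smul_tmul (π.app U a) _ _)
      (fun m v v' => by
        rw [pullbackSection_add]; exact tmul_add _ _ _)
      (fun a m v => by
        rw [pullbackSection_smul]; exact tmul_smul (π.app U a) _ _))
    (fun U W h m v => by
      refine Eq.trans ?_ (res_tmul (π.preimage_mono h) (M := M) m (pullbackSection π v)).symm
      rw [← pullbackSection_res]; rfl)

lemma projectionMap_tmul (π : X ⟶ Y) (M : X.Modules) (V : Y.Modules) (U : Y.Opens)
    (m : Γ(M, π ⁻¹ᵁ U)) (v : Γ(V, U)) :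
    (projectionMap π M V).app U (tmul (M := (Scheme.Modules.pushforward π).obj M) m v) =
      tmul m (pullbackSection π v) :=
  tensorDesc_tmul _ _ _ _

/-- A frame: sections `e` inducing an isomorphism `𝒪_U^n ≅ V|_U`. -/
def IsFrame (V : Y.Modules) {U : Y.Opens} {n : ℕ} (e : Fin n → Γ(V, U)) : Prop :=
  ∀ (W : Y.Opens) (h : W ≤ U),
    Function.Bijective (fun a : Fin n → Γ(Y, W) => ∑ i, a i • res V h (e i))

/-- Locally free of finite rank. -/
def IsVectorBundle (V : Y.Modules) : Prop :=
  ∀ y : Y, ∃ (U : Y.Opens) (_ : y ∈ U) (n : ℕ) (e : Fin n → Γ(V, U)), IsFrame V e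


lemma frame_res {V : Y.Modules} {U W : Y.Opens} {n : ℕ} {e : Fin n → Γ(V, U)} (he : IsFrame V e)
    (h : W ≤ U) : IsFrame V (fun i => res V h (e i)) := fun W' h' => by
  simpa only [res_res] using he W' (h'.trans h)

/-- The coordinates of a section in a frame. -/
def IsFrame.coord {V : Y.Modules} {U : Y.Opens} {n : ℕ} {e : Fin n → Γ(V, U)} (he : IsFrame V e)
    {W : Y.Opens} (h : W ≤ U) : Γ(V, W) ≃ₗ[Γ(Y, W)] (Fin n → Γ(Y, W)) :=
  (LinearEquiv.ofBijective
    ({ toFun := fun a => ∑ i, a i • res V h (e i)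
       map_add' := fun a b => by simp [add_smul, Finset.sum_add_distrib]
       map_smul' := fun r a => by simp [Finset.smul_sum, mul_smul] } :
      (Fin n → Γ(Y, W)) →ₗ[Γ(Y, W)] Γ(V, W)) (he W h)).symm

section frame
variable {V : Y.Modules} {U : Y.Opens} {n : ℕ} {e : Fin n → Γ(V, U)} (he : IsFrame V e)

lemma IsFrame.sum_coord {W : Y.Opens} (h : W ≤ U) (v : Γ(V, W)) :
    ∑ i, he.coord h v i • res V h (e i) = v := (he.coord h).symm_apply_apply v

lemma IsFrame.coord_sum {W : Y.Opens} (h : W ≤ U) (a : Fin n → Γ(Y, W)) :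
    he.coord h (∑ i, a i • res V h (e i)) = a := (he.coord h).apply_symm_apply a

lemma IsFrame.coord_e {W : Y.Opens} (h : W ≤ U) (i : Fin n) :
    he.coord h (res V h (e i)) = Pi.single i 1 := by
  rw [← he.coord_sum h (Pi.single i 1)]
  congr 1
  rw [Finset.sum_eq_single i] <;> simp +contextual

lemma res_smul {V : Y.Modules} {U W : Y.Opens} (h : W ≤ U) (a : Γ(Y, U)) (v : Γ(V, U)) :
    res V h (a • v) = Y.presheaf.map (homOfLE h).op a • res V h v :=
  Scheme.Modules.map_smul _ _ _ _

lemma IsFrame.coord_res {W W' : Y.Opens} (h : W ≤ U) (h' : W' ≤ W) (v : Γ(V, W)) (i : Fin n) :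
    he.coord (h'.trans h) (res V h' v) i = Y.presheaf.map (homOfLE h').op (he.coord h v i) := by
  have : res V h' v = ∑ i, Y.presheaf.map (homOfLE h').op (he.coord h v i) •
      res V (h'.trans h) (e i) := by
    conv_lhs => rw [← he.sum_coord h v]
    refine (map_sum (V.presheaf.map (homOfLE h').op).hom _ _).trans ?_
    refine Finset.sum_congr rfl fun i _ => ?_
    refine (res_smul h' _ _).trans ?_
    rw [res_res]
  rw [this, he.coord_sum]

end frame

/-- An affine open set of `Y` together with a frame of `V` over it. -/
structure Chart (V : Y.Modules) : Type u where
  U : Y.Opens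
  isAffine : IsAffineOpen U
  n : ℕ
  e : Fin n → Γ(V, U)
  frame : IsFrame V e

instance (V : Y.Modules) : Preorder (Chart V) := Preorder.lift Chart.U

variable {V : Y.Modules}

lemma Chart.le {i j : Chart V} (h : i ≤ j) : i.U ≤ j.U := h

/-- The change of frame: `i.e a = ∑ b, frameChange h a b • j.e b` over `i.U`. -/
def frameChange {i j : Chart V} (h : i ≤ j) (a : Fin i.n) (b : Fin j.n) : Γ(Y, i.U) :=
  j.frame.coord h (i.e a) b

lemma frameChange_self (i : Chart V) (a b : Fin i.n) :
    frameChange (le_refl i) a b = if b = a then 1 else 0 := by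
  have := i.frame.coord_e (le_refl i.U) a
  rw [res_self] at this
  exact (congrFun this b).trans (by simp [Pi.single_apply])

lemma frameChange_trans {i j k : Chart V} (h : i ≤ j) (h' : j ≤ k) (a : Fin i.n) (c : Fin k.n) :
    frameChange (h.trans h') a c =
      ∑ b, frameChange h a b * Y.presheaf.map (homOfLE (Chart.le h)).op (frameChange h' b c) := by
  unfold frameChange
  conv_lhs => rw [← j.frame.sum_coord h (i.e a)]
  rw [map_sum, Finset.sum_apply]
  refine Finset.sum_congr rfl fun b _ => ?_
  rw [map_smul, Pi.smul_apply, smul_eq_mul]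
  congr 1
  exact k.frame.coord_res h' h (j.e b) c

/-- The coordinate ring of `Tot(V)` over a chart: polynomials in the fibre coordinates. -/
abbrev Chart.ring (i : Chart V) : Type u := MvPolynomial (Fin i.n) Γ(Y, i.U)

/-- The transition map of coordinate rings: the `b`-th fibre coordinate of `∑ a, t a • i.e a`
in the frame of `j` is `∑ a, t a * frameChange h a b`. -/
def transRing {i j : Chart V} (h : i ≤ j) : j.ring →+* i.ring :=
  MvPolynomial.eval₂Hom (MvPolynomial.C.comp (Y.presheaf.map (homOfLE (Chart.le h)).op).hom)
    (fun b => ∑ a, MvPolynomial.C (frameChange h a b) * MvPolynomial.X a)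

lemma transRing_C {i j : Chart V} (h : i ≤ j) (r : Γ(Y, j.U)) :
    transRing h (MvPolynomial.C r) = MvPolynomial.C (Y.presheaf.map (homOfLE (Chart.le h)).op r) := by
  simp [transRing]

lemma transRing_X {i j : Chart V} (h : i ≤ j) (b : Fin j.n) :
    transRing h (MvPolynomial.X b) =
      ∑ a, MvPolynomial.C (frameChange h a b) * MvPolynomial.X a := by
  simp [transRing]

lemma map_self (U : Y.Opens) (r : Γ(Y, U)) : Y.presheaf.map (homOfLE (le_refl U)).op r = r :=
  congr(($(Y.presheaf.map_id (.op U))).hom r)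

lemma map_map {U W W' : Y.Opens} (h : W ≤ U) (h' : W' ≤ W) (r : Γ(Y, U)) :
    Y.presheaf.map (homOfLE h').op (Y.presheaf.map (homOfLE h).op r) =
      Y.presheaf.map (homOfLE (h'.trans h)).op r := by
  have := Y.presheaf.map_comp (homOfLE h).op (homOfLE h').op
  exact congr(($this).hom r).symm

lemma transRing_self (i : Chart V) : transRing (le_refl i) = RingHom.id _ := by
  apply MvPolynomial.ringHom_ext
  · intro r
    rw [transRing_C, map_self]; rfl
  · intro b
    simp [transRing_X, frameChange_self]

lemma transRing_trans {i j k : Chart V} (h : i ≤ j) (h' : j ≤ k) :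
    (transRing h).comp (transRing h') = transRing (h.trans h') := by
  apply MvPolynomial.ringHom_ext
  · intro r
    rw [RingHom.comp_apply, transRing_C, transRing_C, transRing_C, map_map]
  · intro c
    rw [RingHom.comp_apply, transRing_X, transRing_X, map_sum]
    simp only [map_mul, transRing_C, transRing_X, frameChange_trans h h', map_sum]
    simp only [Finset.mul_sum, Finset.sum_mul]
    rw [Finset.sum_comm]
    refine Finset.sum_congr rfl fun a _ => Finset.sum_congr rfl fun b _ => ?_
    ring

/-- The coordinate rings of the charts of `Tot(V)`. -/
def ringFunctor (V : Y.Modules) : (Chart V)ᵒᵖ ⥤ CommRingCat.{u} where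
  obj i := .of i.unop.ring
  map f := CommRingCat.ofHom (transRing f.unop.le)
  map_id i := by
    ext1
    exact transRing_self i.unop
  map_comp f g := by
    ext1
    exact (transRing_trans g.unop.le f.unop.le).symm

/-- The open sets of the charts. -/
def chartOpens (V : Y.Modules) : Chart V ⥤ Y.Opens :=
  Monotone.functor (f := Chart.U) fun _ _ h => h

/-- The structure maps of the coordinate rings. -/
def ringStr (V : Y.Modules) : (chartOpens V).op ⋙ Y.presheaf ⟶ ringFunctor V where
  app i := CommRingCat.ofHom (MvPolynomial.C : Γ(Y, i.unop.U) →+* i.unop.ring)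
  naturality i j f := by
    ext r
    exact (transRing_C f.unop.le r).symm

lemma frameChange_inv {i j : Chart V} (h : i ≤ j) :
  ∃ d : Fin j.n → Fin i.n → Γ(Y, i.U),
    (∀ a a', ∑ b, frameChange h a b * d b a' = if a' = a then 1 else 0) ∧
    (∀ b b', ∑ a, d b a * frameChange h a b' = if b' = b then 1 else 0) := by
  refine ⟨fun b => i.frame.coord le_rfl (res V (Chart.le h) (j.e b)), fun a a' => ?_, fun b b' => ?_⟩
  · have h1 := j.frame.sum_coord (Chart.le h) (i.e a)
    have h2 := i.frame.coord_e le_rfl a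
    rw [res_self, ← h1, map_sum] at h2
    have h3 := congrFun h2 a'
    rw [Finset.sum_apply] at h3
    simp only [map_smul, Pi.smul_apply, smul_eq_mul] at h3
    exact h3.trans (by simp [Pi.single_apply])
  · have h1 := i.frame.sum_coord le_rfl (res V (Chart.le h) (j.e b))
    have h2 := j.frame.coord_e (Chart.le h) b
    rw [← h1, map_sum] at h2
    have h3 := congrFun h2 b'
    rw [Finset.sum_apply] at h3
    simp only [map_smul, Pi.smul_apply, smul_eq_mul, res_self] at h3
    exact h3.trans (by simp [Pi.single_apply])

lemma isPushout_transRing {i j : Chart V} (h : i ≤ j) :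
    IsPushout (Y.presheaf.map (homOfLE (Chart.le h)).op)
      (CommRingCat.ofHom (MvPolynomial.C : Γ(Y, j.U) →+* j.ring))
      (CommRingCat.ofHom (MvPolynomial.C : Γ(Y, i.U) →+* i.ring))
      (CommRingCat.ofHom (transRing h)) := by
  obtain ⟨d, h1, h2⟩ := frameChange_inv h
  refine ⟨⟨?_⟩, ⟨PushoutCocone.IsColimit.mk _
    (fun s => CommRingCat.ofHom (MvPolynomial.eval₂Hom s.inl.hom
      (fun a => ∑ b, s.inl.hom (d b a) * s.inr.hom (MvPolynomial.X b)))) ?_ ?_ ?_⟩⟩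
  · ext1
    apply RingHom.ext
    intro r
    exact (transRing_C h r).symm
  · intro s
    ext r
    simp
  · intro s
    have w (r) : s.inl.hom (Y.presheaf.map (homOfLE (Chart.le h)).op r) =
        s.inr.hom (MvPolynomial.C r) := congr(($s.condition).hom r)
    ext1
    apply MvPolynomial.ringHom_ext
    · intro r
      simp only [CommRingCat.hom_comp, CommRingCat.hom_ofHom, RingHom.comp_apply, transRing_C]
      simpa using w r
    · intro b
      simp only [CommRingCat.hom_comp, CommRingCat.hom_ofHom, RingHom.comp_apply, transRing_X,
        map_sum, map_mul, MvPolynomial.coe_eval₂Hom, MvPolynomial.eval₂_C, MvPolynomial.eval₂_X,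
        Finset.mul_sum]
      rw [Finset.sum_comm]
      have (b' : Fin j.n) : ∑ a, s.inl.hom (frameChange h a b) *
          (s.inl.hom (d b' a) * s.inr.hom (MvPolynomial.X b')) =
          (if b = b' then 1 else 0) * s.inr.hom (MvPolynomial.X b') := by
        rw [← map_one s.inl.hom, ← map_zero s.inl.hom, ← apply_ite s.inl.hom, ← h2, map_sum,
          Finset.sum_mul]
        refine Finset.sum_congr rfl fun a _ => ?_
        rw [map_mul]; ring
      exact (Finset.sum_congr rfl fun b' _ => this b').trans (by simp)
  · intro s m hm hm'
    ext1
    apply MvPolynomial.ringHom_ext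
    · intro r
      simpa using congr(($hm).hom r)
    · intro a
      have (b : Fin j.n) := congr(($hm').hom (MvPolynomial.X b))
      simp only [CommRingCat.hom_comp, CommRingCat.hom_ofHom, RingHom.comp_apply, transRing_X] at this
      have hr (r) := congr(($hm).hom r)
      simp only [CommRingCat.hom_comp, CommRingCat.hom_ofHom, RingHom.comp_apply] at hr
      simp only [CommRingCat.hom_ofHom, MvPolynomial.coe_eval₂Hom, MvPolynomial.eval₂_X, ← this, ← hr]
      simp only [← map_mul, ← map_sum]
      congr 1
      simp only [Finset.mul_sum]
      rw [Finset.sum_comm]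
      have (a' : Fin i.n) : ∑ b, (MvPolynomial.C (d b a) : i.ring) *
          (MvPolynomial.C (frameChange h a' b) * MvPolynomial.X a') =
          (if a = a' then 1 else 0) * MvPolynomial.X a' := by
        rw [← map_one MvPolynomial.C, ← map_zero MvPolynomial.C,
          ← apply_ite MvPolynomial.C, ← h1, map_sum, Finset.sum_mul]
        refine Finset.sum_congr rfl fun b _ => ?_
        rw [map_mul]; ring
      exact ((Finset.sum_congr rfl fun a' _ => this a').trans (by simp)).symm

lemma ringStr_coequifibered (V : Y.Modules) : (ringStr V).Coequifibered :=
  fun _ _ f => isPushout_transRing f.unop.le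

lemma chart_isBasis (hV : IsVectorBundle V) :
    Opens.IsBasis (Set.range (Chart.U (V := V))) := by
  rw [Opens.isBasis_iff_nbhd]
  intro O y hy
  obtain ⟨U, hyU, n, e, he⟩ := hV y
  obtain ⟨_, ⟨W, hW, rfl⟩, hyW, hWU⟩ :=
    Y.isBasis_affineOpens.exists_subset_of_mem_open (show y ∈ (U ⊓ O : Opens Y) from ⟨hyU, hy⟩)
      (U ⊓ O).isOpen
  have hWU' : W ≤ U ⊓ O := hWU
  exact ⟨W, ⟨⟨W, hW, n, _, frame_res he (hWU'.trans inf_le_left)⟩, rfl⟩, hyW,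
    hWU'.trans inf_le_right⟩

/-- The open cover of `Y` by all charts. -/
abbrev chartCover (V : Y.Modules) (hV : IsVectorBundle V) : Y.OpenCover where
  I₀ := Chart V
  X i := i.U
  f i := i.U.ι
  mem₀ := by
    rw [Scheme.presieve₀_mem_precoverage_iff]
    refine ⟨fun y => ?_, inferInstance⟩
    obtain ⟨_, ⟨i, rfl⟩, hy, -⟩ := Opens.isBasis_iff_nbhd.mp (chart_isBasis hV)
      (show y ∈ (⊤ : Opens Y) from trivial)
    exact ⟨i, ⟨y, hy⟩, rfl⟩

instance (hV : IsVectorBundle V) : Preorder (chartCover V hV).I₀ :=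
  inferInstanceAs (Preorder (Chart V))

instance (V : Y.Modules) (hV : IsVectorBundle V) : Small.{u} (chartCover V hV).I₀ :=
  inferInstanceAs (Small.{u} (Chart V))

instance (hV : IsVectorBundle V) : (chartCover V hV).LocallyDirected :=
  .ofIsBasisOpensRange
    (fun {i j} => by
      have (k : Chart V) : (Scheme.Hom.opensRange ((chartCover V hV).f k)
          (H := inferInstanceAs (IsOpenImmersion k.U.ι))) = k.U := k.U.opensRange_ι
      exact (by rw [this i, this j]; rfl))
    (by
      have (k : Chart V) : (Scheme.Hom.opensRange ((chartCover V hV).f k)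
          (H := inferInstanceAs (IsOpenImmersion k.U.ι))) = k.U := k.U.opensRange_ι
      exact (congrArg (fun g => Opens.IsBasis (Set.range g)) (funext this)).mpr (chart_isBasis hV))

lemma chartCover_trans (hV : IsVectorBundle V) {i j : Chart V} (h : i ≤ j) :
    (chartCover V hV).trans (i := i) (j := j) (homOfLE h) = Y.homOfLE (Chart.le h) := by
  have h1 : (chartCover V hV).trans (i := i) (j := j) (homOfLE h) ≫ j.U.ι = i.U.ι :=
    (chartCover V hV).trans_map (i := i) (j := j) (homOfLE h)
  rw [← cancel_mono j.U.ι, Scheme.homOfLE_ι]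
  exact h1

/-- `Spec Γ(Y, U) ≅ U` for the charts. -/
def specIso (V : Y.Modules) (hV : IsVectorBundle V) :
    ((chartOpens V).op ⋙ Y.presheaf).rightOp ⋙ Scheme.Spec ≅
      (chartCover V hV).functorOfLocallyDirected :=
  (NatIso.ofComponents (F := (chartCover V hV).functorOfLocallyDirected)
    (G := ((chartOpens V).op ⋙ Y.presheaf).rightOp ⋙ Scheme.Spec)
    (fun (i : Chart V) => i.isAffine.isoSpec) (fun {i j} f => by
    have h1 : (chartCover V hV).trans f = Y.homOfLE (Chart.le f.le) := chartCover_trans hV f.le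
    have h2 := Scheme.Opens.toSpecΓ_SpecMap_presheaf_map i.U j.U (Chart.le f.le)
    exact (congrArg (· ≫ j.U.toSpecΓ) h1).trans h2.symm)).symm

/-- The gluing datum of `Tot(V)`. -/
def totGluing (V : Y.Modules) (hV : IsVectorBundle V) :
    (chartCover V hV).RelativeGluingData where
  functor := (ringFunctor V).rightOp ⋙ Scheme.Spec
  natTrans := Functor.whiskerRight (NatTrans.rightOp (ringStr V)) Scheme.Spec ≫ (specIso V hV).hom
  equifibered := ((ringStr_coequifibered V).rightOp.whiskerRight _).comp (.of_isIso _)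

/-- The total space of a vector bundle. -/
def Tot (V : Y.Modules) (hV : IsVectorBundle V) : Scheme.{u} := (totGluing V hV).glued

/-- The bundle projection. -/
def Tot.proj (V : Y.Modules) (hV : IsVectorBundle V) : Tot V hV ⟶ Y := (totGluing V hV).toBase

/-- The inclusion of a chart `U × 𝔸ⁿ` into the total space. -/
def Tot.chart (hV : IsVectorBundle V) (i : Chart V) : Spec (.of i.ring) ⟶ Tot V hV :=
  (totGluing V hV).cover.f i

instance (hV : IsVectorBundle V) (i : Chart V) : IsOpenImmersion (Tot.chart hV i) :=
  (totGluing V hV).cover.map_prop i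

lemma Tot.chart_proj (hV : IsVectorBundle V) (i : Chart V) :
    Tot.chart hV i ≫ Tot.proj V hV =
      Spec.map (CommRingCat.ofHom MvPolynomial.C) ≫ i.isAffine.fromSpec := by
  refine ((totGluing V hV).ι_toBase i).trans ?_
  rfl

/-- `Φ : π_* M ⟶ π_* M ⊗ V` is the pushforward of `σ : M ⟶ M ⊗ π^* V`, `m ↦ m ⊗ σ`, under the
canonical map `π_* M ⊗ V ⟶ π_* (M ⊗ π^* V)`, which is an isomorphism for `V` locally free. -/
def IsInducedHiggsField (π : X ⟶ Y) (M : X.Modules) (V : Y.Modules)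
    (σ : Γ((Scheme.Modules.pullback π).obj V, ⊤))
    (Φ : (Scheme.Modules.pushforward π).obj M ⟶ tensor ((Scheme.Modules.pushforward π).obj M) V) :
    Prop :=
  Φ ≫ projectionMap π M V = (Scheme.Modules.pushforward π).map (tensorSection M σ)

/-- `Φ = ∑ l, φ l ⊗ e l` over the chart `i`, where `e` is the frame of the chart. -/
def IsComponents {E : Y.Modules} (Φ : E ⟶ tensor E V) (i : Chart V)
    (φ : Fin i.n → Module.End Γ(Y, i.U) Γ(E, i.U)) : Prop :=
  ∀ m : Γ(E, i.U), appL Φ i.U m = ∑ l, tmul (φ l m) (i.e l)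

/-- The determinant of `∑ l, z l * (φ l - t l)` on the base change of a module. -/
def pencilDet {A E : Type*} [CommRing A] [AddCommGroup E] [Module A E] {n : ℕ}
    (φ : Fin n → Module.End A E) {R : Type*} [CommRing R] [Algebra A R] (z t : Fin n → R) : R :=
  LinearMap.det (∑ l, z l • ((φ l).baseChange R -
    t l • (LinearMap.id : R ⊗[A] E →ₗ[R] R ⊗[A] E)))

/-- The determinant of `Φ - η = ∑ l, (φ l - t l) ⊗ e l` over the generic point of `Y`, where
`E` becomes a vector space. The inner variables `t l` are the fibre coordinates of `Tot(V)`, so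
that the tautological section is `η = ∑ l, t l e l`. The outer variables `z l` stand for the
frame `e l` of `V`, so that the determinant, which is homogeneous in `z` of degree the rank of
`E`, is a section of `Sym V` with coefficients that are functions on `Tot(V)`. -/
def genericDet [IsIntegral Y] {E : Y.Modules} (i : Chart V) [Nonempty i.U]
    (φ : Fin i.n → Module.End Γ(Y, i.U) Γ(E, i.U)) :
    MvPolynomial (Fin i.n) (MvPolynomial (Fin i.n) Y.functionField) :=
  pencilDet φ MvPolynomial.X (fun l => MvPolynomial.C (MvPolynomial.X l))

/-- The ideal of the spectral cover in a chart: it is generated by the coefficients of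
`det (Φ - η)` with respect to the monomials in the frame of `V`. (For `E` coherent and
torsion-free and `Y` normal, each coefficient is a polynomial over `Γ(Y, U)`.) -/
def spectralIdeal [IsIntegral Y] {E : Y.Modules} (Φ : E ⟶ tensor E V) (i : Chart V) :
    Ideal i.ring :=
  Ideal.span {P | ∃ (_ : Nonempty i.U) (φ : Fin i.n → Module.End Γ(Y, i.U) Γ(E, i.U))
    (α : Fin i.n →₀ ℕ), IsComponents Φ i φ ∧
      MvPolynomial.map (algebraMap Γ(Y, i.U) Y.functionField) P = (genericDet i φ).coeff α}

/-- The chart `U × 𝔸ⁿ` as an affine open set of `Tot(V)`. -/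
def Tot.chartOpen (hV : IsVectorBundle V) (i : Chart V) : (Tot V hV).affineOpens :=
  ⟨Tot.chart hV i ''ᵁ ⊤, (isAffineOpen_top _).image_of_isOpenImmersion _⟩

/-- The coordinate ring of a chart, as functions on the corresponding open set of `Tot(V)`. -/
def Tot.chartSection (hV : IsVectorBundle V) (i : Chart V) :
    i.ring →+* Γ(Tot V hV, (Tot.chartOpen hV i).1) :=
  ((Scheme.ΓSpecIso (.of i.ring)).inv ≫ ((Tot.chart hV i).appIso ⊤).inv).hom

/-- The ideal sheaf of the spectral cover: the smallest one that contains the ideals in the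
charts. -/
def spectralIdealSheaf [IsIntegral Y] (hV : IsVectorBundle V) {E : Y.Modules}
    (Φ : E ⟶ tensor E V) : (Tot V hV).IdealSheafData :=
  sInf {J | ∀ i : Chart V,
    (spectralIdeal Φ i).map (Tot.chartSection hV i) ≤ J.ideal (Tot.chartOpen hV i)}

/-- The spectral cover `C_Φ`, the closed subscheme `det (Φ - η) = 0` of `Tot(V)`. -/
def SpectralCover [IsIntegral Y] (hV : IsVectorBundle V) {E : Y.Modules}
    (Φ : E ⟶ tensor E V) : Scheme.{u} :=
  (spectralIdealSheaf hV Φ).subscheme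

/-- The projection `C_Φ ⟶ Y`. -/
def SpectralCover.proj [IsIntegral Y] (hV : IsVectorBundle V) {E : Y.Modules}
    (Φ : E ⟶ tensor E V) : SpectralCover hV Φ ⟶ Y :=
  (spectralIdealSheaf hV Φ).subschemeι ≫ Tot.proj V hV

/-- `ν : N ⟶ Z` is the normalization of the irreducible scheme `Z` (that is, of its reduction):
`N` is integral and normal, and `ν` is integral and birational onto the reduction of `Z`. -/
structure IsNormalization {N Z : Scheme.{u}} [IsIntegral N] (ν : N ⟶ Z) : Prop where
  normal : ∀ x : N, IsIntegrallyClosed (N.presheaf.stalk x)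
  isIntegralHom : IsIntegralHom ν
  isDominant : IsDominant ν
  birational : Function.Bijective (ν.residueFieldMap (genericPoint N))

/-- The degree `[K(X) : K(Y)]` of a dominant morphism, computed at the generic point of `X`. -/
def degree [IsIntegral X] (π : X ⟶ Y) : ℕ :=
  letI := (π.stalkMap (genericPoint X)).hom.toAlgebra
  Module.finrank (Y.presheaf.stalk (π (genericPoint X))) (X.presheaf.stalk (genericPoint X))

/-- Torsion-free coherent sheaves on an integral (Noetherian) scheme. -/
structure IsTorsionFreeCoherent (M : X.Modules) : Prop where
  isQuasicoherent : M.IsQuasicoherent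
  finite : ∀ U : X.Opens, IsAffineOpen U → Module.Finite Γ(X, U) Γ(M, U)
  torsionFree : ∀ (U : X.Opens) (a : Γ(X, U)) (m : Γ(M, U)), a ≠ 0 → a • m = 0 → m = 0

instance (n : ℕ) : GradedAlgebra (MvPolynomial.homogeneousSubmodule (Fin (n + 1)) ℂ) :=
  MvPolynomial.gradedAlgebra

/-- Projective space over `ℂ`. -/
def complexProjectiveSpace (n : ℕ) : Scheme.{0} :=
  Proj (MvPolynomial.homogeneousSubmodule (Fin (n + 1)) ℂ)

/-- The structure morphism of projective space over `ℂ`. -/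
def complexProjectiveSpace.str (n : ℕ) : complexProjectiveSpace n ⟶ Spec (.of ℂ) :=
  Proj.toSpecZero (MvPolynomial.homogeneousSubmodule (Fin (n + 1)) ℂ) ≫
    Spec.map (CommRingCat.ofHom
      (algebraMap ℂ (MvPolynomial.homogeneousSubmodule (Fin (n + 1)) ℂ 0)))

/-- Smooth projective complex varieties (integral schemes, smooth over `ℂ`, and closed
subschemes of a projective space over `ℂ`). -/
structure IsSmoothProjectiveVariety {X : Scheme.{0}} (s : X ⟶ Spec (.of ℂ)) : Prop where
  isIntegral : IsIntegral X
  smooth : Smooth s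
  projective : ∃ (n : ℕ) (j : X ⟶ complexProjectiveSpace n),
    IsClosedImmersion j ∧ j ≫ complexProjectiveSpace.str n = s

end HiggsCover
end

open CategoryTheory AlgebraicGeometry HiggsCover

/-! Over an affine open `U` of `Y` with a frame `e l` of `V`, put `A = Γ(Y, U)`, `B = Γ(X, π⁻¹U)`,
`E = Γ(M, π⁻¹U)` and write `σ = ∑ s l • π^*(e l)` with `s l ∈ B`. Then `Φ = ∑ s l ⊗ e l`, where `s
l` acts on `E` by multiplication (`isComponents_mulEnd`), and `σ` amounts to a morphism `X ⟶ Tot(V)`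
over `Y`, given in the chart by `A[t] → B`, `t l ↦ s l`.

If all coordinates `s l` in all charts come from `Y`, the local sections `∑ s l • e l` glue to some
`τ` with `π^*τ = σ`, and `Φ = τ ⊗ id`. Otherwise some `s l` is not in `A`; since `A` is integrally
closed and `s l` is integral over it, `s l` is not in `K(Y)` either, and primality of the degree
forces `K(Y)(s l) = K(X)`. This is birationality (`residueFieldMap_toSpectralCover_bijective`).

That `X ⟶ Tot(V)` factors through `C_Φ` with dense image rests on one factorization. Over an
algebraic closure `k` of `K(Y)`, the space `k ⊗ E` is a finite-dimensional module over a commutative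
algebra, so a filtration with simple quotients gives characters `c : B → k` with `det ∑ z l (s l - t
l) = ∏ over c of ∑ z l (c (s l) - t l)` (`exists_list_genericPencil`). Each `c` is injective, so
substituting `t = c(s)` shows that the coefficients of the determinant vanish at `s` as soon as `E`
is generically nonzero (`aeval_eq_zero_of_map_eq_coeff_genericPencil`). Conversely, at a point of
`Tot(V)` where all coefficients vanish, the specialized product is zero, hence one linear factor is,
and the point is a specialization of `c(s)`: every polynomial vanishing at `s` vanishes there
(`mem_of_forall_coeff_genericPencil_mem`). Thus the kernel of `A[t] → B` and the spectral ideal have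
the same radical.

Integrality follows from finiteness of `π`, and normality of `X` and `Y` from smoothness. The sheaf
`M = 0` is treated apart: its determinant is `1`, its spectral cover is empty, and `Φ = 0`. -/

open CategoryTheory Limits TopologicalSpace AlgebraicGeometry
open scoped AlgebraicGeometry TensorProduct

noncomputable section
namespace HiggsCover

/-! ### Coordinates on `E ⊗ V` in a frame of `V` -/

section
variable {X Y : Scheme.{u}}

/-- The trace of an open set `W` on `U`, written as an image under the inclusion of `U`. -/
abbrev trace (U W : X.Opens) : X.Opens := U.ι ''ᵁ U.ι ⁻¹ᵁ W

lemma trace_le_left (U W : X.Opens) : trace U W ≤ U := by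
  rintro x ⟨y, -, rfl⟩
  exact y.2

lemma trace_le_right (U W : X.Opens) : trace U W ≤ W := U.ι.image_preimage_le W

lemma trace_mono (U : X.Opens) {W W' : X.Opens} (h : W' ≤ W) : trace U W' ≤ trace U W :=
  Scheme.Hom.image_mono _ (Scheme.Hom.preimage_mono _ h)

lemma le_trace {U W : X.Opens} (h : W ≤ U) : W ≤ trace U W :=
  fun x hx => ⟨⟨x, h hx⟩, hx, rfl⟩

/-- The sheaf `j_* j^* N` for the inclusion `j` of an open set. -/
def extend (N : X.Modules) (U : X.Opens) : X.Modules :=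
  (Scheme.Modules.pushforward U.ι).obj ((Scheme.Modules.restrictFunctor U.ι).obj N)

/-- The sections of `j_* j^* N` over `W` are the sections of `N` over the trace of `W`. -/
def extendEquiv (N : X.Modules) (U W : X.Opens) : Γ(extend N U, W) ≃+ Γ(N, trace U W) :=
  AddEquiv.refl _

lemma extendEquiv_smul (N : X.Modules) (U W : X.Opens) (a : Γ(X, W)) (s : Γ(extend N U, W)) :
    extendEquiv N U W (a • s) =
      X.presheaf.map (homOfLE (trace_le_right U W)).op a • extendEquiv N U W s := by
  have h : (U.ι.appIso (U.ι ⁻¹ᵁ W)).inv (U.ι.app W a) =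
      X.presheaf.map (homOfLE (trace_le_right U W)).op a := by
    rw [← CommRingCat.comp_apply, Scheme.Hom.app_appIso_inv]
    rfl
  rw [← h]
  rfl

lemma extendEquiv_res (N : X.Modules) (U : X.Opens) {W W' : X.Opens} (h : W' ≤ W)
    (s : Γ(extend N U, W)) :
    extendEquiv N U W' (res (extend N U) h s) = res N (trace_mono U h) (extendEquiv N U W s) :=
  rfl


/-- The restriction morphism `N ⟶ j_* j^* N`. -/
def toExtend (N : X.Modules) (U : X.Opens) : N ⟶ extend N U :=
  homMk (fun W =>
    { toFun := fun s => (extendEquiv N U W).symm (res N (trace_le_right U W) s)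
      map_add' := fun s t => by
        rw [← map_add]
        exact congrArg _ (map_add (N.presheaf.map _).hom s t)
      map_smul' := fun a s => by
        apply (extendEquiv N U W).injective
        rw [RingHom.id_apply, extendEquiv_smul, AddEquiv.apply_symm_apply,
          AddEquiv.apply_symm_apply]
        exact res_smul _ a s })
    (fun W W' h s => by
      apply (extendEquiv N U W').injective
      rw [extendEquiv_res]
      simp only [LinearMap.coe_mk, AddHom.coe_mk, AddEquiv.apply_symm_apply, res_res])

lemma extendEquiv_toExtend (N : X.Modules) (U W : X.Opens) (s : Γ(N, W)) :
    extendEquiv N U W ((toExtend N U).app W s) = res N (trace_le_right U W) s := rfl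

section tensorCoord

variable {E V : X.Modules} {U : X.Opens} {n : ℕ} {e : Fin n → Γ(V, U)}

lemma res_add (M : X.Modules) {U W : X.Opens} (h : W ≤ U) (s t : Γ(M, U)) :
    res M h (s + t) = res M h s + res M h t := map_add (M.presheaf.map _).hom s t

lemma res_sum (M : X.Modules) {ι : Type*} (S : Finset ι) {U W : X.Opens} (h : W ≤ U)
    (s : ι → Γ(M, U)) : res M h (∑ i ∈ S, s i) = ∑ i ∈ S, res M h (s i) :=
  map_sum (M.presheaf.map (homOfLE h).op).hom _ _

/-- The coordinate morphism `E ⊗ V ⟶ j_* j^* E` of a frame of `V` over `U`. -/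
def tensorCoord (E : X.Modules) (he : IsFrame V e) (l : Fin n) : tensor E V ⟶ extend E U :=
  tensorDesc
    (fun W => LinearMap.mk₂ Γ(X, W)
      (fun m v => (extendEquiv E U W).symm
        (he.coord (trace_le_left U W) (res V (trace_le_right U W) v) l •
          res E (trace_le_right U W) m))
      (fun m m' v => by rw [res_add, smul_add, map_add])
      (fun a m v => by
        apply (extendEquiv E U W).injective
        rw [extendEquiv_smul, AddEquiv.apply_symm_apply, AddEquiv.apply_symm_apply, res_smul,
          smul_comm])
      (fun m v v' => by rw [res_add, map_add, Pi.add_apply, add_smul, map_add])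
      (fun a m v => by
        apply (extendEquiv E U W).injective
        rw [extendEquiv_smul, AddEquiv.apply_symm_apply, AddEquiv.apply_symm_apply, res_smul,
          map_smul, Pi.smul_apply, smul_assoc]))
    (fun W W' h m v => by
      apply (extendEquiv E U W').injective
      rw [extendEquiv_res]
      simp only [LinearMap.mk₂_apply, AddEquiv.apply_symm_apply, res_res, res_smul]
      rw [← he.coord_res (trace_le_left U W) (trace_mono U h), res_res])

lemma extendEquiv_tensorCoord (he : IsFrame V e) (l : Fin n) {W : X.Opens} (m : Γ(E, W))
    (v : Γ(V, W)) :
    extendEquiv E U W ((tensorCoord E he l).app W (tmul m v)) =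
      he.coord (trace_le_left U W) (res V (trace_le_right U W) v) l •
        res E (trace_le_right U W) m := by
  unfold tensorCoord
  rw [tensorDesc_tmul]
  rfl

lemma tmul_sum {M N : X.Modules} {ι : Type*} (S : Finset ι) (m : Γ(M, U)) (f : ι → Γ(N, U)) :
    tmul m (∑ i ∈ S, f i) = ∑ i ∈ S, tmul m (f i) := by
  simp only [tmul, TensorProduct.tmul_sum, map_sum]

/-- Every section of `E ⊗ V` is the sum of its coordinates in a frame of `V`. -/
lemma sum_tensorCoord (he : IsFrame V e) {W : X.Opens} (s : Γ(tensor E V, W)) :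
    ∑ l, tmul (extendEquiv E U W ((tensorCoord E he l).app W s)) (res V (trace_le_left U W) (e l)) =
      res (tensor E V) (trace_le_right U W) s := by
  let f : tensor E V ⟶ extend (tensor E V) U := homMk
    (fun W =>
      { toFun := fun s => (extendEquiv (tensor E V) U W).symm (∑ l,
          tmul (extendEquiv E U W ((tensorCoord E he l).app W s)) (res V (trace_le_left U W) (e l)))
        map_add' := fun s t => by
          rw [← map_add, ← Finset.sum_add_distrib]
          congr 2
          funext l
          rw [← add_tmul, ← map_add]
          congr 2
          exact map_add ((tensorCoord E he l).app W).hom s t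
        map_smul' := fun a s => by
          apply (extendEquiv (tensor E V) U W).injective
          rw [RingHom.id_apply, extendEquiv_smul, AddEquiv.apply_symm_apply,
            AddEquiv.apply_symm_apply, Finset.smul_sum]
          congr 1
          funext l
          rw [← smul_tmul, ← extendEquiv_smul, Scheme.Modules.Hom.app_smul] })
    (fun W W' h s => by
      apply (extendEquiv (tensor E V) U W').injective
      rw [extendEquiv_res]
      simp only [LinearMap.coe_mk, AddHom.coe_mk, AddEquiv.apply_symm_apply]
      rw [res_sum]
      congr 1
      funext l
      rw [res_tmul, res_res, app_res, extendEquiv_res])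
  -- Both sides are morphisms out of a tensor product, so pure tensors suffice. The target `j_* j^*`
  -- makes the frame, which exists only over `U`, usable in a morphism of sheaves on all of `X`; no
  -- description of sections of the sheafification is needed.
  have hf : f = toExtend (tensor E V) U := by
    apply tensor_hom_ext
    intro W m v
    apply (extendEquiv (tensor E V) U W).injective
    rw [extendEquiv_toExtend, res_tmul, homMk_app]
    simp only [LinearMap.coe_mk, AddHom.coe_mk, AddEquiv.apply_symm_apply,
      extendEquiv_tensorCoord, smul_tmul, ← tmul_smul]
    rw [← tmul_sum, he.sum_coord]
  exact congrArg (fun g : tensor E V ⟶ extend (tensor E V) U =>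
    extendEquiv (tensor E V) U W (g.app W s)) hf

/-- The coordinate morphisms recover each `m l`, which gives injectivity; `sum_tensorCoord` shows
that the coordinates of a section reproduce it, which gives surjectivity. -/
lemma sum_tmul_frame_bijective (he : IsFrame V e) {W : X.Opens} (h : W ≤ U) :
    Function.Bijective (fun m : Fin n → Γ(E, W) => ∑ l, tmul (m l) (res V h (e l))) := by
  constructor
  · intro m m' hm
    funext l
    have key (m : Fin n → Γ(E, W)) : extendEquiv E U W ((tensorCoord E he l).app W
        (∑ l, tmul (m l) (res V h (e l)))) = res E (trace_le_right U W) (m l) := by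
      rw [show (tensorCoord E he l).app W (∑ l, tmul (m l) (res V h (e l))) =
        ∑ k, (tensorCoord E he l).app W (tmul (m k) (res V h (e k))) from
        map_sum ((tensorCoord E he l).app W).hom _ _, map_sum]
      simp only [extendEquiv_tensorCoord, res_res, he.coord_e]
      rw [Finset.sum_eq_single l]
      · simp
      · intro k _ hk
        simp [hk.symm]
      · simp
    have := congrArg (fun s => res E (le_trace h)
      (extendEquiv E U W ((tensorCoord E he l).app W s))) hm
    simpa only [key, res_res, res_self] using this
  · intro s
    refine ⟨fun l => res E (le_trace h) (extendEquiv E U W ((tensorCoord E he l).app W s)), ?_⟩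
    have := congrArg (res (tensor E V) (le_trace h)) (sum_tensorCoord he s)
    rw [res_res, res_self, res_sum] at this
    simpa only [res_tmul, res_res] using this

end tensorCoord

end

/-! ### Pullback of frames and the projection formula -/

section
variable {X Y : Scheme.{u}}

section pullback

variable (π : X ⟶ Y) {V : Y.Modules}

/-- A morphism out of `π^* V` from a morphism `V ⟶ π_* N`. -/
def pullbackDesc {N : X.Modules} (ψ : V ⟶ (Scheme.Modules.pushforward π).obj N) :
    (Scheme.Modules.pullback π).obj V ⟶ N :=
  ((Scheme.Modules.pullbackPushforwardAdjunction π).homEquiv V N).symm ψ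

lemma pullbackDesc_pullbackSection {N : X.Modules}
    (ψ : V ⟶ (Scheme.Modules.pushforward π).obj N) {W : Y.Opens} (v : Γ(V, W)) :
    (pullbackDesc π ψ).app (π ⁻¹ᵁ W) (pullbackSection π v) = ψ.app W v := by
  have h := (Scheme.Modules.pullbackPushforwardAdjunction π).homEquiv_unit V N (pullbackDesc π ψ)
  rw [pullbackDesc, Equiv.apply_symm_apply] at h
  exact congrArg (fun g : V ⟶ (Scheme.Modules.pushforward π).obj N => g.app W v) h.symm

lemma pullback_hom_ext {N : X.Modules} {f g : (Scheme.Modules.pullback π).obj V ⟶ N}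
    (h : ∀ (W : Y.Opens) (v : Γ(V, W)), f.app (π ⁻¹ᵁ W) (pullbackSection π v) =
      g.app (π ⁻¹ᵁ W) (pullbackSection π v)) : f = g := by
  apply ((Scheme.Modules.pullbackPushforwardAdjunction π).homEquiv V N).injective
  rw [Adjunction.homEquiv_unit, Adjunction.homEquiv_unit]
  apply Scheme.Modules.hom_ext
  intro W
  ext v
  exact h W v

/-- The structure sheaf as a sheaf of modules. -/
abbrev unit (X : Scheme.{u}) : X.Modules := SheafOfModules.unit X.ringCatSheaf

/-- Sections of the structure sheaf. -/
def unitEquiv (U : X.Opens) : Γ(unit X, U) ≃ₗ[Γ(X, U)] Γ(X, U) := LinearEquiv.refl _ _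

lemma unitEquiv_res {U W : X.Opens} (h : W ≤ U) (s : Γ(unit X, U)) :
    unitEquiv W (res (unit X) h s) = X.presheaf.map (homOfLE h).op (unitEquiv U s) := rfl

lemma preimage_trace (U W : Y.Opens) : trace (π ⁻¹ᵁ U) (π ⁻¹ᵁ W) ≤ π ⁻¹ᵁ (trace U W) := by
  intro x hx
  have h1 : x ∈ π ⁻¹ᵁ U := trace_le_left _ _ hx
  have h2 : x ∈ π ⁻¹ᵁ W := trace_le_right _ _ hx
  exact ⟨⟨π x, h1⟩, h2, rfl⟩

/-- The sections of the pushforward. -/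
def pushEquiv (N : X.Modules) (W : Y.Opens) :
    Γ((Scheme.Modules.pushforward π).obj N, W) ≃+ Γ(N, π ⁻¹ᵁ W) := AddEquiv.refl _

lemma pushEquiv_smul (N : X.Modules) (W : Y.Opens) (a : Γ(Y, W))
    (s : Γ((Scheme.Modules.pushforward π).obj N, W)) :
    pushEquiv π N W (a • s) = π.app W a • pushEquiv π N W s := rfl

lemma app_presheaf_map {U W : Y.Opens} (h : W ≤ U) (a : Γ(Y, U)) :
    π.app W (Y.presheaf.map (homOfLE h).op a) =
      X.presheaf.map (homOfLE (π.preimage_mono h)).op (π.app U a) := by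
  exact congr(($(π.naturality (homOfLE h).op)).hom a)

variable {U : Y.Opens} {n : ℕ} {e : Fin n → Γ(V, U)}

/-- The pullback of the coordinate of a section of `V` in a frame over `U`. -/
def pullbackCoordAux (he : IsFrame V e) (l : Fin n) {W : Y.Opens} (v : Γ(V, W)) :
    Γ(X, trace (π ⁻¹ᵁ U) (π ⁻¹ᵁ W)) :=
  X.presheaf.map (homOfLE (preimage_trace π U W)).op (π.app _
    (he.coord (trace_le_left U W) (res V (trace_le_right U W) v) l))

lemma pullbackCoordAux_add (he : IsFrame V e) (l : Fin n) {W : Y.Opens} (v v' : Γ(V, W)) :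
    pullbackCoordAux π he l (v + v') = pullbackCoordAux π he l v + pullbackCoordAux π he l v' := by
  unfold pullbackCoordAux
  rw [res_add, map_add, Pi.add_apply, map_add, map_add]

lemma pullbackCoordAux_smul (he : IsFrame V e) (l : Fin n) {W : Y.Opens} (a : Γ(Y, W))
    (v : Γ(V, W)) :
    pullbackCoordAux π he l (a • v) =
      X.presheaf.map (homOfLE (trace_le_right _ _)).op (π.app W a) * pullbackCoordAux π he l v := by
  unfold pullbackCoordAux
  rw [res_smul, map_smul, Pi.smul_apply, smul_eq_mul, map_mul, map_mul, app_presheaf_map, map_map]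

lemma pullbackCoordAux_res (he : IsFrame V e) (l : Fin n) {W W' : Y.Opens} (h : W' ≤ W)
    (v : Γ(V, W)) :
    pullbackCoordAux π he l (res V h v) =
      X.presheaf.map (homOfLE (trace_mono _ (π.preimage_mono h))).op
        (pullbackCoordAux π he l v) := by
  unfold pullbackCoordAux
  rw [map_map, res_res, ← res_res (trace_le_right U W) (trace_mono U h),
    he.coord_res (trace_le_left U W) (trace_mono U h), app_presheaf_map, map_map]

/-- The identification of sections of `π_* j_* 𝒪` with functions. -/
def pushExtendUnitEquiv (U W : Y.Opens) :
    Γ((Scheme.Modules.pushforward π).obj (extend (unit X) (π ⁻¹ᵁ U)), W) ≃+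
      Γ(X, trace (π ⁻¹ᵁ U) (π ⁻¹ᵁ W)) :=
  (pushEquiv π _ W).trans ((extendEquiv (unit X) (π ⁻¹ᵁ U) (π ⁻¹ᵁ W)).trans
    (unitEquiv _).toAddEquiv)

lemma pushExtendUnitEquiv_smul (U W : Y.Opens) (a : Γ(Y, W))
    (s : Γ((Scheme.Modules.pushforward π).obj (extend (unit X) (π ⁻¹ᵁ U)), W)) :
    pushExtendUnitEquiv π U W (a • s) =
      X.presheaf.map (homOfLE (trace_le_right _ _)).op (π.app W a) *
        pushExtendUnitEquiv π U W s := by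
  unfold pushExtendUnitEquiv
  simp only [AddEquiv.trans_apply]
  rw [pushEquiv_smul, extendEquiv_smul]
  exact map_smul (unitEquiv _) _ _

lemma pushExtendUnitEquiv_res (U : Y.Opens) {W W' : Y.Opens} (h : W' ≤ W)
    (s : Γ((Scheme.Modules.pushforward π).obj (extend (unit X) (π ⁻¹ᵁ U)), W)) :
    pushExtendUnitEquiv π U W' (res _ h s) =
      X.presheaf.map (homOfLE (trace_mono _ (π.preimage_mono h))).op
        (pushExtendUnitEquiv π U W s) := rfl

/-- The coordinate morphism `π^* V ⟶ j_* 𝒪` of a frame of `V` over `U`. -/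
def pullbackCoord (he : IsFrame V e) (l : Fin n) :
    (Scheme.Modules.pullback π).obj V ⟶ extend (unit X) (π ⁻¹ᵁ U) :=
  pullbackDesc π (homMk (fun W =>
    { toFun := fun v => (pushExtendUnitEquiv π U W).symm (pullbackCoordAux π he l v)
      map_add' := fun v v' => by rw [pullbackCoordAux_add, map_add]
      map_smul' := fun a v => by
        apply (pushExtendUnitEquiv π U W).injective
        rw [RingHom.id_apply, pushExtendUnitEquiv_smul, AddEquiv.apply_symm_apply,
          AddEquiv.apply_symm_apply, pullbackCoordAux_smul] })
    (fun W W' h v => by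
      apply (pushExtendUnitEquiv π U W').injective
      rw [pushExtendUnitEquiv_res]
      simp only [LinearMap.coe_mk, AddHom.coe_mk, AddEquiv.apply_symm_apply]
      rw [pullbackCoordAux_res]))

/-- The value of the coordinate morphism, as a function. -/
def pullbackCoordFun (he : IsFrame V e) (l : Fin n) {W : X.Opens}
    (s : Γ((Scheme.Modules.pullback π).obj V, W)) : Γ(X, trace (π ⁻¹ᵁ U) W) :=
  unitEquiv _ (extendEquiv (unit X) (π ⁻¹ᵁ U) W ((pullbackCoord π he l).app W s))

lemma pullbackCoordFun_pullbackSection (he : IsFrame V e) (l : Fin n) {W : Y.Opens} (v : Γ(V, W)) :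
    pullbackCoordFun π he l (pullbackSection π v) =
      pullbackCoordAux π he l v := by
  unfold pullbackCoordFun pullbackCoord
  rw [pullbackDesc_pullbackSection]
  rfl

lemma pullbackCoordFun_add (he : IsFrame V e) (l : Fin n) {W : X.Opens}
    (s t : Γ((Scheme.Modules.pullback π).obj V, W)) :
    pullbackCoordFun π he l (s + t) = pullbackCoordFun π he l s + pullbackCoordFun π he l t := by
  unfold pullbackCoordFun
  rw [← map_add, ← map_add]
  congr 2
  exact map_add ((pullbackCoord π he l).app W).hom s t

lemma pullbackCoordFun_smul (he : IsFrame V e) (l : Fin n) {W : X.Opens} (a : Γ(X, W))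
    (s : Γ((Scheme.Modules.pullback π).obj V, W)) :
    pullbackCoordFun π he l (a • s) =
      X.presheaf.map (homOfLE (trace_le_right _ W)).op a * pullbackCoordFun π he l s := by
  unfold pullbackCoordFun
  rw [Scheme.Modules.Hom.app_smul, extendEquiv_smul, map_smul, smul_eq_mul]

lemma pullbackCoordFun_res (he : IsFrame V e) (l : Fin n) {W W' : X.Opens} (h : W' ≤ W)
    (s : Γ((Scheme.Modules.pullback π).obj V, W)) :
    pullbackCoordFun π he l (res _ h s) =
      X.presheaf.map (homOfLE (trace_mono _ h)).op (pullbackCoordFun π he l s) := by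
  unfold pullbackCoordFun
  rw [app_res, extendEquiv_res, unitEquiv_res]

/-- Every section of `π^* V` is the combination of the pullback of a frame with its coordinates. -/
lemma sum_pullbackCoordFun (he : IsFrame V e) {W : X.Opens}
    (s : Γ((Scheme.Modules.pullback π).obj V, W)) :
    ∑ l, pullbackCoordFun π he l s • res _ (trace_le_left (π ⁻¹ᵁ U) W) (pullbackSection π (e l)) =
      res _ (trace_le_right (π ⁻¹ᵁ U) W) s := by
  let P := (Scheme.Modules.pullback π).obj V
  let f : P ⟶ extend P (π ⁻¹ᵁ U) := homMk
    (fun W =>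
      { toFun := fun s => (extendEquiv P (π ⁻¹ᵁ U) W).symm (∑ l,
          pullbackCoordFun π he l s •
            res P (trace_le_left (π ⁻¹ᵁ U) W) (pullbackSection π (e l)))
        map_add' := fun s t => by
          rw [← map_add, ← Finset.sum_add_distrib]
          congr 2
          funext l
          rw [← add_smul, pullbackCoordFun_add]
        map_smul' := fun a s => by
          apply (extendEquiv P (π ⁻¹ᵁ U) W).injective
          rw [RingHom.id_apply, extendEquiv_smul, AddEquiv.apply_symm_apply,
            AddEquiv.apply_symm_apply, Finset.smul_sum]
          congr 1
          funext l
          rw [pullbackCoordFun_smul, mul_smul] })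
    (fun W W' h s => by
      apply (extendEquiv P (π ⁻¹ᵁ U) W').injective
      rw [extendEquiv_res]
      simp only [LinearMap.coe_mk, AddHom.coe_mk, AddEquiv.apply_symm_apply]
      rw [res_sum]
      congr 1
      funext l
      rw [res_smul, res_res, pullbackCoordFun_res])
  -- By adjunction a morphism out of `π^* V` is determined on the sections `π^* v`, for which the
  -- identity is the pullback of the expansion of `v` in the frame.
  have hf : f = toExtend P (π ⁻¹ᵁ U) := by
    apply pullback_hom_ext
    intro W v
    apply (extendEquiv P (π ⁻¹ᵁ U) (π ⁻¹ᵁ W)).injective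
    rw [extendEquiv_toExtend, homMk_app]
    simp only [LinearMap.coe_mk, AddHom.coe_mk, AddEquiv.apply_symm_apply]
    have h1 := congrArg (fun v => res P (preimage_trace π U W) (pullbackSection π v))
      (he.sum_coord (trace_le_left U W) (res V (trace_le_right U W) v))
    rw [pullbackSection_res, res_res] at h1
    rw [← h1, show pullbackSection π (∑ i, he.coord (trace_le_left U W)
        (res V (trace_le_right U W) v) i • res V (trace_le_left U W) (e i)) =
        ∑ i, pullbackSection π (he.coord (trace_le_left U W)
        (res V (trace_le_right U W) v) i • res V (trace_le_left U W) (e i)) from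
      map_sum (appL ((Scheme.Modules.pullbackPushforwardAdjunction π).unit.app V) _) _ _, res_sum]
    refine Finset.sum_congr rfl fun l _ => ?_
    rw [pullbackSection_smul, res_smul, pullbackSection_res, res_res,
      pullbackCoordFun_pullbackSection, pullbackCoordAux]
  exact congrArg (fun g : P ⟶ extend P (π ⁻¹ᵁ U) => extendEquiv P (π ⁻¹ᵁ U) W (g.app W s)) hf

/-- The pullback of a frame is a frame. -/
lemma IsFrame.pullback (he : IsFrame V e) :
    IsFrame ((Scheme.Modules.pullback π).obj V) (fun l => pullbackSection π (e l)) := by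
  intro W h
  constructor
  · intro a a' haa
    funext l
    have key (a : Fin n → Γ(X, W)) : pullbackCoordFun π he l
        (∑ l, a l • res ((Scheme.Modules.pullback π).obj V) h (pullbackSection π (e l))) =
          X.presheaf.map (homOfLE (trace_le_right _ W)).op (a l) := by
      rw [show pullbackCoordFun π he l (∑ l, a l • res ((Scheme.Modules.pullback π).obj V) h (pullbackSection π (e l))) =
        ∑ k, pullbackCoordFun π he l (a k • res ((Scheme.Modules.pullback π).obj V) h
          (pullbackSection π (e k))) from map_sum (AddMonoidHom.mk' (pullbackCoordFun π he l) (pullbackCoordFun_add π he l)) _ _]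
      simp only [pullbackCoordFun_smul, pullbackCoordFun_res, pullbackCoordFun_pullbackSection,
        pullbackCoordAux, he.coord_e]
      rw [Finset.sum_eq_single l]
      · simp
      · intro k _ hk
        simp [hk.symm]
      · simp
    have := congrArg (fun s => X.presheaf.map (homOfLE (le_trace h)).op
      (pullbackCoordFun π he l s)) haa
    simpa only [key, map_map, map_self] using this
  · intro s
    refine ⟨fun l => X.presheaf.map (homOfLE (le_trace h)).op (pullbackCoordFun π he l s), ?_⟩
    have := congrArg (res _ (le_trace h)) (sum_pullbackCoordFun π he s)
    rw [res_res, res_self, res_sum] at this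
    simpa only [res_smul, res_res] using this

end pullback

section projection

variable (π : X ⟶ Y) (M : X.Modules) {V : Y.Modules} {U : Y.Opens} {n : ℕ} {e : Fin n → Γ(V, U)}

lemma projectionMap_sum_tmul {W : Y.Opens} (h : W ≤ U) (e : Fin n → Γ(V, U))
    (m : Fin n → Γ(M, π ⁻¹ᵁ W)) :
    (projectionMap π M V).app W
      (∑ l, tmul (M := (Scheme.Modules.pushforward π).obj M) (m l) (res V h (e l))) =
      ∑ l, tmul (m l) (res _ (π.preimage_mono h) (pullbackSection π (e l))) := by
  refine (map_sum ((projectionMap π M V).app W).hom _ _).trans (Finset.sum_congr rfl fun l _ => ?_)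
  rw [← pullbackSection_res]
  exact projectionMap_tmul π M V W (m l) (res V h (e l))

/-- The frame `e` and its pullback identify both sides with `n` copies of `Γ(M, π⁻¹W)`, and in these
coordinates the projection map is the identity. -/
lemma projectionMap_app_bijective (he : IsFrame V e) {W : Y.Opens} (h : W ≤ U) :
    Function.Bijective ((projectionMap π M V).app W) := by
  have h1 := sum_tmul_frame_bijective (E := (Scheme.Modules.pushforward π).obj M) he h
  have h2 := sum_tmul_frame_bijective (E := M) (he.pullback π) (π.preimage_mono h)
  rw [← Function.Bijective.of_comp_iff _ h1]
  have h3 : (projectionMap π M V).app W ∘ (fun m => ∑ l,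
      tmul (M := (Scheme.Modules.pushforward π).obj M) (m l) (res V h (e l))) =
      fun m : Fin n → Γ(M, π ⁻¹ᵁ W) => ∑ l, tmul (m l)
        (res _ (π.preimage_mono h) (pullbackSection π (e l))) :=
    funext (projectionMap_sum_tmul π M h e)
  exact (congrArg Function.Bijective h3).mpr h2

lemma isIso_projectionMap (hV : IsVectorBundle V) : IsIso (projectionMap π M V) := by
  rw [← isIso_iff_of_reflects_iso _ (Scheme.Modules.toPresheaf Y)]
  let F : TopCat.Sheaf Ab Y := ⟨_, Scheme.Modules.isSheaf (tensor ((Scheme.Modules.pushforward π).obj M) V)⟩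
  let G : TopCat.Sheaf Ab Y := ⟨_, Scheme.Modules.isSheaf ((Scheme.Modules.pushforward π).obj
    (tensor M ((Scheme.Modules.pullback π).obj V)))⟩
  let α : F ⟶ G := ⟨(Scheme.Modules.toPresheaf Y).map (projectionMap π M V)⟩
  have : IsIso α := by
    refine TopCat.Sheaf.isIso_iff_isIso_basis (chart_isBasis hV) fun i => ?_
    rw [ConcreteCategory.isIso_iff_bijective]
    exact projectionMap_app_bijective π M i.frame le_rfl
  exact inferInstanceAs (IsIso ((TopCat.Sheaf.forget Ab Y).map α))

lemma existsUnique_isInducedHiggsField (hV : IsVectorBundle V)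
    (σ : Γ((Scheme.Modules.pullback π).obj V, ⊤)) : ∃! Φ, IsInducedHiggsField π M V σ Φ := by
  have := isIso_projectionMap π M hV
  refine ⟨(Scheme.Modules.pushforward π).map (tensorSection M σ) ≫ inv (projectionMap π M V),
    by simp [IsInducedHiggsField], fun Φ hΦ => ?_⟩
  rw [IsIso.eq_comp_inv]
  exact hΦ

end projection

end

/-! ### Components of the induced Higgs field -/

section
variable {X Y : Scheme.{u}}

section components

variable (π : X ⟶ Y) {M : X.Modules} {V : Y.Modules}

/-- The coordinates over a chart of a section of `π^* V`. -/
def sectionCoord (σ : Γ((Scheme.Modules.pullback π).obj V, ⊤)) (i : Chart V) :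
    Fin i.n → Γ(X, π ⁻¹ᵁ i.U) :=
  (i.frame.pullback π).coord le_rfl (res _ le_top σ)

lemma sum_sectionCoord (σ : Γ((Scheme.Modules.pullback π).obj V, ⊤)) (i : Chart V) :
    ∑ l, sectionCoord π σ i l • pullbackSection π (i.e l) = res _ le_top σ := by
  have := (i.frame.pullback π).sum_coord le_rfl (res _ le_top σ)
  simp only [res_self] at this
  exact this

lemma pullbackSection_sum {ι : Type*} (S : Finset ι) {U : Y.Opens} (v : ι → Γ(V, U)) :
    pullbackSection π (∑ i ∈ S, v i) = ∑ i ∈ S, pullbackSection π (v i) :=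
  map_sum (appL ((Scheme.Modules.pullbackPushforwardAdjunction π).unit.app V) _) _ _

/-- The coordinates of `σ` transform by the same matrix as the fibre coordinates in `transRing`;
this is what lets the local maps to `Tot(V)` glue. -/
lemma sectionCoord_trans (σ : Γ((Scheme.Modules.pullback π).obj V, ⊤)) {i j : Chart V} (h : i ≤ j)
    (b : Fin j.n) :
    X.presheaf.map (homOfLE (π.preimage_mono (Chart.le h))).op (sectionCoord π σ j b) =
      ∑ a, π.app i.U (frameChange h a b) * sectionCoord π σ i a := by
  rw [sectionCoord, ← (j.frame.pullback π).coord_res le_rfl (π.preimage_mono (Chart.le h)), res_res]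
  have h1 := sum_sectionCoord π σ i
  have h2 (a : Fin i.n) := congrArg (pullbackSection π) (j.frame.sum_coord h (i.e a))
  simp only [← h2, pullbackSection_sum, pullbackSection_smul, Finset.smul_sum, smul_smul,
    pullbackSection_res] at h1
  rw [Finset.sum_comm] at h1
  simp only [← Finset.sum_smul] at h1
  rw [← h1, (j.frame.pullback π).coord_sum]
  refine Finset.sum_congr rfl fun a _ => mul_comm _ _

/-- Multiplication by a function on the preimage, as an endomorphism of sections of `π_* M`. -/
def mulEnd (M : X.Modules) {U : Y.Opens} (b : Γ(X, π ⁻¹ᵁ U)) :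
    Module.End Γ(Y, U) Γ((Scheme.Modules.pushforward π).obj M, U) where
  toFun m := (pushEquiv π M U).symm (b • pushEquiv π M U m)
  map_add' m m' := by rw [map_add, smul_add, map_add]
  map_smul' a m := by
    apply (pushEquiv π M U).injective
    rw [RingHom.id_apply, pushEquiv_smul, AddEquiv.apply_symm_apply, pushEquiv_smul,
      AddEquiv.apply_symm_apply, smul_comm]

variable {σ : Γ((Scheme.Modules.pullback π).obj V, ⊤)}
  {Φ : (Scheme.Modules.pushforward π).obj M ⟶ tensor ((Scheme.Modules.pushforward π).obj M) V}

/-- After the injective map `projectionMap`, both sides become `m ⊗ σ`. -/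
lemma isComponents_mulEnd (hΦ : IsInducedHiggsField π M V σ Φ) (i : Chart V) :
    IsComponents Φ i (fun l => mulEnd π M (sectionCoord π σ i l)) := by
  intro m
  apply (projectionMap_app_bijective π M i.frame le_rfl).1
  have h1 : (projectionMap π M V).app i.U (Φ.app i.U m) =
      tmul (pushEquiv π M i.U m) (res _ le_top σ) :=
    congrArg (fun g : (Scheme.Modules.pushforward π).obj M ⟶ _ => g.app i.U m) hΦ
  have h2 := projectionMap_sum_tmul π M le_rfl i.e
    (fun l => sectionCoord π σ i l • pushEquiv π M i.U m)
  simp only [res_self, smul_tmul] at h2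
  simp only [← tmul_smul] at h2
  rw [← tmul_sum, sum_sectionCoord] at h2
  exact h1.trans h2.symm

/-- Components in a frame are unique, so the quantifier over `φ` in `spectralIdeal` only ever ranges
over multiplication by the coordinates of `σ`. -/
lemma IsComponents.eq_mulEnd (hΦ : IsInducedHiggsField π M V σ Φ) {i : Chart V}
    {φ : Fin i.n → Module.End Γ(Y, i.U) Γ((Scheme.Modules.pushforward π).obj M, i.U)}
    (hφ : IsComponents Φ i φ) : φ = fun l => mulEnd π M (sectionCoord π σ i l) := by
  funext l
  ext m
  have h := (hφ m).symm.trans (isComponents_mulEnd π hΦ i m)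
  have := (sum_tmul_frame_bijective (E := (Scheme.Modules.pushforward π).obj M) i.frame
    (le_refl i.U)).1 (a₁ := fun l => φ l m)
    (a₂ := fun l => mulEnd π M (sectionCoord π σ i l) m) (by simpa only [res_self] using h)
  exact congrFun this l

lemma isInducedHiggsField_tensorSection {τ : Γ(V, ⊤)} (hτ : pullbackSection π τ = σ) :
    IsInducedHiggsField π M V σ (tensorSection ((Scheme.Modules.pushforward π).obj M) τ) := by
  apply Scheme.Modules.hom_ext
  intro U
  ext m
  refine (projectionMap_tmul π M V U m (res V le_top τ)).trans ?_
  rw [pullbackSection_res, hτ]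
  rfl

end components

end

/-! ### Characters of commuting families of endomorphisms -/

section commuting

variable {k : Type*} [Field k] [IsAlgClosed k] {B : Type*} [CommRing B] [Algebra k B]

/-- A simple module that is finite-dimensional over an algebraically closed field `k` has scalars
acting through a character. -/
lemma exists_algHom_smul_eq (S : Type*) [AddCommGroup S] [Module k S] [Module B S]
    [IsScalarTower k B S] [FiniteDimensional k S] [IsSimpleModule B S] :
    ∃ χ : B →ₐ[k] k, ∀ (b : B) (x : S), b • x = χ b • x := by
  obtain ⟨m, hm, ⟨e⟩⟩ := isSimpleModule_iff_quot_maximal.mp ‹IsSimpleModule B S›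
  let _ : Field (B ⧸ m) := Ideal.Quotient.field m
  have : FiniteDimensional k (B ⧸ m) := Module.Finite.equiv (e.restrictScalars k)
  have hbij := IsAlgClosed.algebraMap_bijective_of_isIntegral (k := k) (K := B ⧸ m)
  let e' : k ≃ₐ[k] B ⧸ m := AlgEquiv.ofBijective (Algebra.ofId k (B ⧸ m)) hbij
  refine ⟨e'.symm.toAlgHom.comp (Ideal.Quotient.mkₐ k m), fun b x => ?_⟩
  apply e.injective
  have h1 : algebraMap k (B ⧸ m) (e'.symm (Ideal.Quotient.mk m b)) = Ideal.Quotient.mk m b :=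
    e'.apply_symm_apply _
  have h2 : e (e'.symm (Ideal.Quotient.mk m b) • x) = e'.symm (Ideal.Quotient.mk m b) • e x :=
    map_smul (e.restrictScalars k) _ _
  change e (b • x) = e (e'.symm (Ideal.Quotient.mk m b) • x)
  rw [map_smul, h2, Algebra.smul_def (e'.symm (Ideal.Quotient.mk m b)), h1]
  rfl

/-- Simultaneous triangularization: split off a simple submodule, on which `B` acts through a
character, and use multiplicativity of the determinant for `S ⊆ W`. The point is that one list of
characters serves every `b`. -/
lemma exists_list_det_lsmul (W : Type*) [AddCommGroup W] [Module k W] [Module B W]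
    [IsScalarTower k B W] [FiniteDimensional k W] :
    ∃ χ : List (B →ₐ[k] k), χ.length = Module.finrank k W ∧
      ∀ b : B, LinearMap.det (Algebra.lsmul k k W b) = (χ.map fun c => c b).prod := by
  induction h : Module.finrank k W using Nat.strong_induction_on generalizing W with
  | _ d ih =>
  rcases subsingleton_or_nontrivial W with hW | hW
  · refine ⟨[], by simp [← h, Module.finrank_zero_of_subsingleton], fun b => ?_⟩
    rw [LinearMap.det_eq_one_of_subsingleton]
    simp
  have : IsArtinian B W := isArtinian_of_tower k inferInstance
  obtain ⟨S, hS⟩ := IsAtomic.exists_atom (Submodule B W)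
  have : IsSimpleModule B S := isSimpleModule_iff_isAtom.mpr hS
  let S' := S.restrictScalars k
  have : FiniteDimensional k S := inferInstanceAs (FiniteDimensional k S')
  obtain ⟨c, hc⟩ := exists_algHom_smul_eq (k := k) (B := B) S
  have hd : Module.finrank k (W ⧸ S) + Module.finrank k S = Module.finrank k W :=
    Submodule.finrank_quotient_add_finrank S'
  have hS0 : 0 < Module.finrank k S := by
    have := IsSimpleModule.nontrivial B S
    exact Module.finrank_pos
  obtain ⟨χ, hχ, hdet⟩ := ih _ (by lia) (W ⧸ S) rfl
  -- The simple module is in fact a line; repeating its character `finrank k S` times avoids having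
  -- to prove this.
  refine ⟨List.replicate (Module.finrank k S) c ++ χ, by simp; lia, fun b => ?_⟩
  have he : S' ≤ S'.comap (Algebra.lsmul k k W b) := fun x hx => S.smul_mem b hx
  rw [LinearMap.det_eq_det_mul_det S' _ he, List.map_append, List.prod_append, ← hdet]
  congr 1
  have : (Algebra.lsmul k k W b).restrict (p := S') (q := S') (fun _ hx => he hx) = c b • LinearMap.id := by
    ext x
    exact congrArg Subtype.val (hc b x)
  rw [this, LinearMap.det_smul, LinearMap.det_id, mul_one, List.map_replicate, List.prod_replicate]
  rfl

end commuting

/-! ### Determinants of pencils and their factorization into linear forms -/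

section pencil

variable {A E : Type*} [CommRing A] [AddCommGroup E] [Module A E] {n : ℕ}

/-- Determinants commute with base change, and `R' ⊗ (R ⊗ E)` is `R' ⊗ E`. Freeness over `R` keeps
`LinearMap.det` from taking its default value `1`. -/
lemma map_pencilDet {R R' : Type*} [CommRing R] [CommRing R'] [Algebra A R] [Algebra A R']
    [Module.Finite A E] [Module.Free R (R ⊗[A] E)] (φ : Fin n → Module.End A E) (f : R →ₐ[A] R')
    (z t : Fin n → R) : f (pencilDet φ z t) = pencilDet φ (f ∘ z) (f ∘ t) := by
  let _ : Algebra R R' := f.toRingHom.toAlgebra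
  have : IsScalarTower A R R' := .of_algebraMap_eq fun a => (f.commutes a).symm
  have hf (r : R) (x : R') : r • x = f r * x := rfl
  change algebraMap R R' (LinearMap.det _) = _
  rw [← LinearMap.det_baseChange, pencilDet, ← LinearMap.det_conj _
    (TensorProduct.AlgebraTensorModule.cancelBaseChange A R R' R' E)]
  congr 1
  ext x
  simp only [TensorProduct.AlgebraTensorModule.curry_apply, TensorProduct.curry_apply,
    LinearMap.coe_restrictScalars, LinearMap.sum_apply, LinearMap.smul_apply, LinearMap.sub_apply,
    LinearMap.baseChange_tmul, LinearMap.id_apply, LinearMap.comp_apply,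
    LinearEquiv.coe_coe, TensorProduct.AlgebraTensorModule.cancelBaseChange_symm_tmul,
    TensorProduct.tmul_sum, TensorProduct.tmul_smul, TensorProduct.tmul_sub, map_sum]
  refine Finset.sum_congr rfl fun l _ => ?_
  have hz (y : R' ⊗[R] (R ⊗[A] E)) : z l • y = f (z l) • y := (algebraMap_smul R' (z l) y).symm
  have ht (y : R' ⊗[R] (R ⊗[A] E)) : t l • y = f (t l) • y := (algebraMap_smul R' (t l) y).symm
  rw [hz, ht, map_smul, map_sub, map_smul]
  simp

/-- `E` need not be free over `A`, but `R ⊗ E` is the base change of the `K`-vector space `K ⊗ E`.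
-/
lemma free_baseChange_of_field (K : Type*) [Field K] [Algebra A K] (R : Type*) [CommRing R]
    [Algebra A R] [Algebra K R] [IsScalarTower A K R] : Module.Free R (R ⊗[A] E) :=
  Module.Free.of_equiv (TensorProduct.AlgebraTensorModule.cancelBaseChange A K R R E)

variable {B : Type*} [CommRing B] [Algebra A B] (ρ : B →ₐ[A] Module.End A E)

/-- The pencil is the action of the single element `∑ z l (1 ⊗ s l - t l)` of the commutative
algebra `k ⊗ B` on `k ⊗ E`. The characters depend on none of `s`, `z`, `t`, so the formula can later
be read as a polynomial identity. -/
lemma exists_list_pencilDet (k : Type*) [Field k] [IsAlgClosed k] [Algebra A k]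
    [Module.Finite A E] :
    ∃ χ : List (B →ₐ[A] k), χ.length = Module.finrank k (k ⊗[A] E) ∧
      ∀ (s : Fin n → B) (z t : Fin n → k), pencilDet (fun l => ρ (s l)) z t =
        (χ.map fun c => ∑ l, z l * (c (s l) - t l)).prod := by
  let ψ : k ⊗[A] B →ₐ[k] Module.End k (k ⊗[A] E) :=
    Algebra.TensorProduct.lift (Algebra.ofId k _) ((Module.End.baseChangeHom A k E).comp ρ)
      (fun a b => Algebra.commutes a _)
  let _ : Module (k ⊗[A] B) (k ⊗[A] E) := Module.compHom _ ψ.toRingHom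
  have hsmul (b : k ⊗[A] B) (x : k ⊗[A] E) : b • x = ψ b x := rfl
  have : IsScalarTower k (k ⊗[A] B) (k ⊗[A] E) := ⟨fun a b x => by
    rw [hsmul, hsmul, map_smul]; rfl⟩
  obtain ⟨χ, hχ, hdet⟩ := exists_list_det_lsmul (k := k) (B := k ⊗[A] B) (k ⊗[A] E)
  refine ⟨χ.map fun c => (c.restrictScalars A).comp Algebra.TensorProduct.includeRight, by simpa,
    fun s z t => ?_⟩
  have h := hdet (∑ l, z l • (1 ⊗ₜ s l - algebraMap k _ (t l)))
  simp only [map_sum, map_smul, map_sub, AlgHom.commutes] at h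
  rw [List.map_map]
  refine Eq.trans ?_ h
  unfold pencilDet
  congr 1
  ext x
  simp [hsmul, ψ, Module.End.baseChangeHom]
  rfl

end pencil

section incidence

variable {n : ℕ} {R R' : Type*} [CommRing R] [CommRing R']

/-- The bilinear form `∑ l, z l * (c l - t l)`, a polynomial in `z` over polynomials in `t`. -/
def incidenceForm (c : Fin n → R) : MvPolynomial (Fin n) (MvPolynomial (Fin n) R) :=
  ∑ l, MvPolynomial.X l *
    (MvPolynomial.C (MvPolynomial.C (c l)) - MvPolynomial.C (MvPolynomial.X l))

lemma map_incidenceForm (f : R →+* R') (c : Fin n → R) :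
    MvPolynomial.map (MvPolynomial.map f) (incidenceForm c) = incidenceForm (f ∘ c) := by
  simp [incidenceForm]

lemma map_eval₂Hom_incidenceForm (f : R →+* R') (t : Fin n → R') (c : Fin n → R) :
    MvPolynomial.map (MvPolynomial.eval₂Hom f t) (incidenceForm c) =
      ∑ l, MvPolynomial.X l * MvPolynomial.C (f (c l) - t l) := by
  simp [incidenceForm]

lemma mvPolynomial_funext₂ [IsDomain R] [Infinite R]
    {p q : MvPolynomial (Fin n) (MvPolynomial (Fin n) R)}
    (h : ∀ t z : Fin n → R, MvPolynomial.eval z (MvPolynomial.map (MvPolynomial.eval t) p) =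
      MvPolynomial.eval z (MvPolynomial.map (MvPolynomial.eval t) q)) : p = q := by
  ext1 α
  refine MvPolynomial.funext fun t => ?_
  rw [← MvPolynomial.coeff_map, ← MvPolynomial.coeff_map, MvPolynomial.funext (h t)]

lemma sum_X_mul_C_eq_zero_iff (a : Fin n → R) :
    ∑ l, (MvPolynomial.X l : MvPolynomial (Fin n) R) * MvPolynomial.C (a l) = 0 ↔ a = 0 := by
  refine ⟨fun h => ?_, fun h => by simp [h]⟩
  funext l
  have := congrArg (MvPolynomial.eval (Pi.single l 1)) h
  simpa [Pi.single_apply] using this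

end incidence

/-! ### The spectral ideal and the polynomials vanishing at `s` -/

section generic

variable {A E B : Type*} [CommRing A] [AddCommGroup E] [Module A E] [Module.Finite A E]
  [CommRing B] [Algebra A B] (ρ : B →ₐ[A] Module.End A E) {n : ℕ}

/-- An algebraically closed field is infinite, so the factorization at all points `(z, t)` of
`exists_list_pencilDet` is an identity of polynomials. -/
lemma exists_list_pencilDet_eq_incidenceForm (k : Type*) [Field k] [IsAlgClosed k] [Algebra A k] :
    ∃ χ : List (B →ₐ[A] k), χ.length = Module.finrank k (k ⊗[A] E) ∧
      ∀ s : Fin n → B, pencilDet (R := MvPolynomial (Fin n) (MvPolynomial (Fin n) k))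
        (fun l => ρ (s l)) MvPolynomial.X (fun l => MvPolynomial.C (MvPolynomial.X l)) =
        (χ.map fun c : B →ₐ[A] k => incidenceForm (c ∘ s)).prod := by
  obtain ⟨χ, hχ, h⟩ := exists_list_pencilDet (n := n) ρ k
  refine ⟨χ, hχ, fun s => ?_⟩
  have : Infinite k := IsAlgClosed.instInfinite
  refine mvPolynomial_funext₂ fun t z => ?_
  have := free_baseChange_of_field (A := A) (E := E) k
    (MvPolynomial (Fin n) (MvPolynomial (Fin n) k))
  let f : MvPolynomial (Fin n) (MvPolynomial (Fin n) k) →ₐ[A] k :=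
    ((MvPolynomial.aeval z).restrictScalars A).comp
      (MvPolynomial.mapAlgHom ((MvPolynomial.aeval t).restrictScalars A))
  have hf (p) : f p = MvPolynomial.eval z (MvPolynomial.map (MvPolynomial.eval t) p) := rfl
  rw [← hf, ← hf, map_pencilDet, map_list_prod, List.map_map]
  have hz : f ∘ MvPolynomial.X = z := by
    funext l
    simp [hf]
  have ht : f ∘ (fun l => MvPolynomial.C (MvPolynomial.X l)) = t := by
    funext l
    simp [hf]
  rw [hz, ht, h]
  congr 2
  funext c
  simp [hf, incidenceForm]

/-- Homomorphisms to algebraically closed fields extend along integral extensions. -/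
lemma exists_algHom_extending {C Ω : Type*} [CommRing C] [IsDomain C] [Algebra A C]
    [FaithfulSMul A C] [Algebra.IsIntegral A C] [Field Ω] [IsAlgClosed Ω] [Algebra A Ω] :
    Nonempty (C →ₐ[A] Ω) := by
  let p := RingHom.ker (algebraMap A Ω)
  have : p.IsPrime := RingHom.ker_isPrime _
  -- `A → Ω` need not be injective. A prime `Q` over its kernel `p` reduces the problem to embedding
  -- the algebraic extension `C ⧸ Q` of `A ⧸ p` into `Ω`.
  obtain ⟨Q, -, hQ, hQp⟩ := Ideal.exists_ideal_over_prime_of_isIntegral p (⊥ : Ideal C) (by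
    rw [← RingHom.ker_eq_comap_bot, (RingHom.injective_iff_ker_eq_bot _).mp
      (FaithfulSMul.algebraMap_injective A C)]
    exact bot_le)
  have : Q.LiesOver p := ⟨hQp.symm⟩
  let _ : Algebra (A ⧸ p) Ω := (RingHom.kerLift (algebraMap A Ω)).toAlgebra
  have : FaithfulSMul (A ⧸ p) Ω :=
    (faithfulSMul_iff_algebraMap_injective _ _).mpr (RingHom.kerLift_injective _)
  have : IsScalarTower A (A ⧸ p) Ω := .of_algebraMap_eq fun a => rfl
  have : Module.IsTorsionFree (A ⧸ p) (C ⧸ Q) :=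
    Module.isTorsionFree_iff_faithfulSMul.mpr
      (Ideal.Quotient.instFaithfulSMul Q p)
  exact ⟨((IsAlgClosed.lift : C ⧸ Q →ₐ[A ⧸ p] Ω).restrictScalars A).comp
    (Ideal.Quotient.mkₐ A Q)⟩

variable (K : Type*) [Field K] [Algebra A K]

/-- The determinant of the generic pencil of the endomorphisms `ρ (s l)` over the field `K`. -/
def genericPencil (s : Fin n → B) : MvPolynomial (Fin n) (MvPolynomial (Fin n) K) :=
  pencilDet (fun l => ρ (s l)) MvPolynomial.X (fun l => MvPolynomial.C (MvPolynomial.X l))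

/-- The base change from `K` to its algebraic closure turns the generic determinant into the product
already found, with as many factors as the generic rank of `E`. -/
lemma exists_list_genericPencil :
    ∃ χ : List (B →ₐ[A] AlgebraicClosure K), χ.length = Module.finrank K (K ⊗[A] E) ∧
      ∀ s : Fin n → B, MvPolynomial.map (MvPolynomial.map (algebraMap K (AlgebraicClosure K)))
        (genericPencil ρ K s) =
          (χ.map fun c : B →ₐ[A] AlgebraicClosure K => incidenceForm (c ∘ s)).prod := by
  obtain ⟨χ, hχ, h⟩ := exists_list_pencilDet_eq_incidenceForm (n := n) ρ (AlgebraicClosure K)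
  refine ⟨χ, ?_, fun s => ?_⟩
  · rw [hχ, ← (TensorProduct.AlgebraTensorModule.cancelBaseChange A K (AlgebraicClosure K)
      (AlgebraicClosure K) E).finrank_eq, Module.finrank_baseChange]
  · have := free_baseChange_of_field (A := A) (E := E) K
      (MvPolynomial (Fin n) (MvPolynomial (Fin n) K))
    let f : MvPolynomial (Fin n) (MvPolynomial (Fin n) K) →ₐ[A]
        MvPolynomial (Fin n) (MvPolynomial (Fin n) (AlgebraicClosure K)) :=
      MvPolynomial.mapAlgHom (MvPolynomial.mapAlgHom
        (IsScalarTower.toAlgHom A K (AlgebraicClosure K)))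
    have hf (p) : f p = MvPolynomial.map (MvPolynomial.map
      (algebraMap K (AlgebraicClosure K))) p := rfl
    rw [← hf, genericPencil, map_pencilDet, ← h s]
    congr 1 <;> funext l <;> simp [hf]

variable [IsFractionRing A K] [Algebra.IsIntegral A B]

/-- The kernel contracts to zero in `A`, and in an integral extension of `A` that is a domain only
the zero ideal does. -/
lemma algHom_injective_of_isIntegral [IsDomain A] [IsDomain B] {k : Type*} [Field k] [Algebra A k] [FaithfulSMul A k]
    (χ : B →ₐ[A] k) : Function.Injective χ := by
  rw [injective_iff_map_eq_zero]
  have : RingHom.ker χ = ⊥ := by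
    apply Ideal.eq_bot_of_comap_eq_bot (R := A)
    change Ideal.comap (algebraMap A B) (RingHom.ker (χ : B →+* k)) = ⊥
    rw [RingHom.comap_ker, ← RingHom.injective_iff_ker_eq_bot]
    have : (χ : B →+* k).comp (algebraMap A B) = algebraMap A k := χ.comp_algebraMap
    exact this ▸ FaithfulSMul.algebraMap_injective A k
  intro a ha
  have h : a ∈ RingHom.ker χ := ha
  rwa [this] at h

/-- A Cayley–Hamilton statement. Positive rank provides a character `c`; at `t = c(s)` its linear
factor, hence the product, vanishes identically in `z`. So `c (P(s)) = P(c(s)) = 0` for each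
coefficient `P`, and `c` is injective. -/
lemma aeval_eq_zero_of_map_eq_coeff_genericPencil [IsDomain A] [IsDomain B]
    (hE : Module.finrank K (K ⊗[A] E) ≠ 0)
    (s : Fin n → B) (P : MvPolynomial (Fin n) A) (α : Fin n →₀ ℕ)
    (hP : MvPolynomial.map (algebraMap A K) P = (genericPencil ρ K s).coeff α) :
    MvPolynomial.aeval s P = 0 := by
  obtain ⟨χ, hχ, h⟩ := exists_list_genericPencil (n := n) ρ K
  have : FaithfulSMul A (AlgebraicClosure K) := .trans A K _
  obtain ⟨c, hc⟩ := List.exists_mem_of_length_pos (l := χ) (by lia)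
  apply algHom_injective_of_isIntegral c
  have h1 := congrArg (fun p => MvPolynomial.map (MvPolynomial.eval (c ∘ s)) p) (h s)
  have h2 : ((χ.map fun c : B →ₐ[A] AlgebraicClosure K => incidenceForm (c ∘ s)).map
      (MvPolynomial.map (MvPolynomial.eval (c ∘ s)))).prod = 0 := by
    apply List.prod_eq_zero
    rw [List.mem_map]
    refine ⟨incidenceForm (c ∘ s), List.mem_map_of_mem hc, ?_⟩
    simp [incidenceForm]
  rw [map_list_prod, h2] at h1
  have h3 := congrArg (MvPolynomial.coeff α) h1
  rw [MvPolynomial.coeff_map, MvPolynomial.coeff_map, ← hP, MvPolynomial.map_map,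
    ← IsScalarTower.algebraMap_eq, MvPolynomial.coeff_zero, MvPolynomial.eval_map] at h3
  rw [map_zero, ← h3, ← MvPolynomial.aeval_def]
  exact MvPolynomial.comp_aeval_apply s c P

/-- The converse up to radicals. The characters take values in the integral closure `C` of `A` in
`k`, and `A → A[t]/q → Ω` extends to `φ : C → Ω`. Applying `φ` to the factorization at the point `t
mod q` gives zero, so `t mod q` equals `φ(c(s))` for some `c`, whence `f(t) = φ(c(f(s))) = 0`. -/
lemma mem_of_forall_coeff_genericPencil_mem [IsIntegrallyClosed A]
    (s : Fin n → B) (q : Ideal (MvPolynomial (Fin n) A)) [q.IsPrime]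
    (hq : ∀ (P : MvPolynomial (Fin n) A) (α : Fin n →₀ ℕ),
      MvPolynomial.map (algebraMap A K) P = (genericPencil ρ K s).coeff α → P ∈ q)
    (f : MvPolynomial (Fin n) A) (hf : MvPolynomial.aeval s f = 0) : f ∈ q := by
  obtain ⟨χ, hχ, h⟩ := exists_list_genericPencil (n := n) ρ K
  let k := AlgebraicClosure K
  have : FaithfulSMul A k := .trans A K _
  let C := integralClosure A k
  let Ω := AlgebraicClosure (FractionRing (MvPolynomial (Fin n) A ⧸ q))
  let ev : MvPolynomial (Fin n) A →ₐ[A] Ω :=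
    (IsScalarTower.toAlgHom A (MvPolynomial (Fin n) A ⧸ q) Ω).comp (Ideal.Quotient.mkₐ A q)
  have hev (g) : ev g = 0 ↔ g ∈ q := by
    rw [← Ideal.Quotient.eq_zero_iff_mem]
    exact map_eq_zero_iff ((algebraMap (FractionRing (MvPolynomial (Fin n) A ⧸ q)) Ω).comp
      (algebraMap (MvPolynomial (Fin n) A ⧸ q) (FractionRing (MvPolynomial (Fin n) A ⧸ q))))
      ((algebraMap (FractionRing (MvPolynomial (Fin n) A ⧸ q)) Ω).injective.comp
        (IsFractionRing.injective _ _))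
  have : FaithfulSMul A C := (faithfulSMul_iff_algebraMap_injective _ _).mpr
    fun a b hab => FaithfulSMul.algebraMap_injective A k (congrArg (algebraMap C k) hab)
  obtain ⟨φ⟩ := exists_algHom_extending (A := A) (C := C) (Ω := Ω)
  let χ' (c : B →ₐ[A] k) : B →ₐ[A] C :=
    c.codRestrict C fun b => (Algebra.IsIntegral.isIntegral (R := A) b).map c
  let G : MvPolynomial (Fin n) (MvPolynomial (Fin n) C) :=
    (χ.map fun c : B →ₐ[A] k => incidenceForm (χ' c ∘ s)).prod
  have hG : MvPolynomial.map (MvPolynomial.map (algebraMap C k)) G =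
      MvPolynomial.map (MvPolynomial.map (algebraMap K k)) (genericPencil ρ K s) := by
    rw [h, map_list_prod, List.map_map]
    congr 2
    funext c
    exact map_incidenceForm _ _
  have hcoeff (α β) : algebraMap C k ((G.coeff α).coeff β) =
      algebraMap K k (((genericPencil ρ K s).coeff α).coeff β) := by
    have := congrArg (fun p => (MvPolynomial.coeff α p).coeff β) hG
    simpa only [MvPolynomial.coeff_map] using this
  -- The coefficients lie in `K`, and the factorization over `C` shows them integral over `A`;
  -- normality of `A` puts them in `A`, so the hypothesis `hq` applies to every coefficient of the
  -- determinant.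
  have hlift (α) : ∃ P : MvPolynomial (Fin n) A,
      MvPolynomial.map (algebraMap A K) P = (genericPencil ρ K s).coeff α := by
    refine MvPolynomial.mem_range_map_iff_coeffs_subset.mpr fun a ha => ?_
    obtain ⟨β, -, rfl⟩ := MvPolynomial.mem_coeffs_iff.mp ha
    apply IsIntegrallyClosed.isIntegral_iff.mp
    have hinj := FaithfulSMul.algebraMap_injective K k
    rw [← isIntegral_algHom_iff (IsScalarTower.toAlgHom A K k) hinj]
    exact (congrArg (IsIntegral A) (hcoeff α β)).mp ((G.coeff α).coeff β).2
  choose P hP using hlift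
  have hPG (α) : MvPolynomial.map (algebraMap A C) (P α) = G.coeff α := by
    apply MvPolynomial.map_injective (algebraMap C k) Subtype.val_injective
    ext β
    rw [MvPolynomial.map_map, ← IsScalarTower.algebraMap_eq, MvPolynomial.coeff_map,
      MvPolynomial.coeff_map, hcoeff, ← hP, MvPolynomial.coeff_map,
      ← IsScalarTower.algebraMap_apply]
  have hzero : MvPolynomial.map (MvPolynomial.eval₂Hom (φ : C →+* Ω) (fun l => ev (.X l))) G = 0 := by
    ext1 α
    rw [MvPolynomial.coeff_map, ← hPG, MvPolynomial.coe_eval₂Hom, MvPolynomial.eval₂_map,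
      MvPolynomial.coeff_zero]
    have : (φ : C →+* Ω).comp (algebraMap A C) = algebraMap A Ω := φ.comp_algebraMap
    rw [this, ← MvPolynomial.aeval_def]
    have h2 : MvPolynomial.aeval (fun l => ev (.X l)) (P α) = ev (P α) := by
      conv_rhs => rw [MvPolynomial.aeval_unique ev]
      rfl
    rw [h2, hev]
    exact hq _ α (hP α)
  -- A polynomial ring over `Ω` is a domain, so a single linear form `∑ z l (φ(c(s l)) - t l)` must
  -- vanish.
  rw [map_list_prod, List.prod_eq_zero_iff, List.map_map, List.mem_map] at hzero
  obtain ⟨c, -, hc⟩ := hzero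
  rw [Function.comp_apply, map_eval₂Hom_incidenceForm, sum_X_mul_C_eq_zero_iff] at hc
  have hc' : (fun l => ev (.X l)) = (φ.comp (χ' c)) ∘ s := by
    funext l
    exact (sub_eq_zero.mp (congrFun hc l)).symm
  rw [← hev, MvPolynomial.aeval_unique ev]
  change MvPolynomial.aeval (fun l => ev (.X l)) f = 0
  rw [hc']
  change MvPolynomial.aeval (fun l => (φ.comp (χ' c)) (s l)) f = 0
  rw [← MvPolynomial.comp_aeval_apply, hf, map_zero]

end generic

/-! ### Smooth schemes over a field are normal -/

section normal

/-- With `F = Frac P`, the ring `T ⊗ F` is a localization of `T` and a domain finite over `F`, hence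
a field. Integral closure commutes with smooth base change, so the closure of `T` in `T ⊗ F` is the
image of `T ⊗ P`, that is, `T`. -/
lemma isIntegrallyClosed_of_etale (P T : Type*) [CommRing P] [IsDomain P] [IsIntegrallyClosed P]
    [CommRing T] [IsDomain T] [Algebra P T] [Algebra.Etale P T] : IsIntegrallyClosed T := by
  let F := FractionRing P
  let _ : Algebra F (T ⊗[P] F) := Algebra.TensorProduct.rightAlgebra
  have hPT : FaithfulSMul P T := Module.isTorsionFree_iff_faithfulSMul.mp inferInstance
  have hle : Algebra.algebraMapSubmonoid T (nonZeroDivisors P) ≤ nonZeroDivisors T :=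
    map_le_nonZeroDivisors_of_injective _ (FaithfulSMul.algebraMap_injective P T) le_rfl
  have hloc : IsLocalization (Algebra.algebraMapSubmonoid T (nonZeroDivisors P)) (T ⊗[P] F) :=
    inferInstance
  have hdom : IsDomain (T ⊗[P] F) := IsLocalization.isDomain_of_le_nonZeroDivisors _ hle
  have hfin : Module.Finite F (F ⊗[P] T) := Algebra.FormallyUnramified.finite_of_free F (F ⊗[P] T)
  have hint : Algebra.IsIntegral F (T ⊗[P] F) := by
    let e : F ⊗[P] T ≃ₐ[F] T ⊗[P] F :=
      AlgEquiv.ofRingEquiv (f := (Algebra.TensorProduct.comm P F T).toRingEquiv) fun x => rfl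
    have : Module.Finite F (T ⊗[P] F) := Module.Finite.equiv e.toLinearEquiv
    infer_instance
  have hfield : IsField (T ⊗[P] F) :=
    isField_of_isIntegral_of_isField' (R := F) (Field.toIsField F)
  have h1 : IsIntegrallyClosed (T ⊗[P] F) := hfield.toField.instIsIntegrallyClosed
  have h2 : IsIntegrallyClosedIn T (T ⊗[P] F) := by
    rw [isIntegrallyClosedIn_iff]
    refine ⟨IsLocalization.injective _ hle, fun {x} hx => ?_⟩
    obtain ⟨y, hy⟩ := (TensorProduct.toIntegralClosure_bijective_of_smooth (R := P) (S := T)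
      (B := F)).2 ⟨x, hx⟩
    have hy' : x = (Algebra.TensorProduct.map (.id T T) (integralClosure P F).val) y :=
      (congrArg Subtype.val hy).symm
    rw [hy']
    clear hy hy'
    induction y with
    | zero => exact ⟨0, by simp⟩
    | add y z hy hz =>
      obtain ⟨a, ha⟩ := hy
      obtain ⟨b, hb⟩ := hz
      exact ⟨a + b, by rw [map_add, map_add, ha, hb]⟩
    | tmul t c =>
      obtain ⟨p, hp⟩ := IsIntegrallyClosed.isIntegral_iff.mp c.2
      refine ⟨p • t, ?_⟩
      rw [Algebra.TensorProduct.map_tmul, Subalgebra.coe_val, ← hp]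
      change (p • t) ⊗ₜ (1 : F) = t ⊗ₜ algebraMap P F p
      rw [TensorProduct.smul_tmul, Algebra.algebraMap_eq_smul_one]
  have h3 : FaithfulSMul T (T ⊗[P] F) :=
    (faithfulSMul_iff_algebraMap_injective T (T ⊗[P] F)).mpr (IsLocalization.injective _ hle)
  exact IsIntegrallyClosed.of_isIntegrallyClosed_of_isIntegrallyClosedIn T (T ⊗[P] F)

/-- Normality is local, and near each maximal ideal a smooth algebra is étale over a polynomial
ring, which is factorial and hence normal. -/
lemma isIntegrallyClosed_of_smooth (k S : Type*) [Field k] [CommRing S] [IsDomain S]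
    [Algebra k S] [Algebra.Smooth k S] : IsIntegrallyClosed S := by
  refine IsIntegrallyClosed.of_localization_maximal fun p _ hp => ?_
  obtain ⟨f, hf, n, _, _, _⟩ :=
    Algebra.IsSmoothAt.exists_isStandardEtale_mvPolynomial (R := k) (p := p)
  have hf0 : f ≠ 0 := fun h => hf (h ▸ p.zero_mem)
  have hle : Submonoid.powers f ≤ nonZeroDivisors S := powers_le_nonZeroDivisors_of_noZeroDivisors hf0
  have : IsDomain (Localization.Away f) := IsLocalization.isDomain_localization hle
  have h1 := isIntegrallyClosed_of_etale (MvPolynomial (Fin n) k) (Localization.Away f)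
  have hle' : Submonoid.powers f ≤ p.primeCompl := by
    rw [Submonoid.powers_le]
    exact hf
  let _ : Algebra (Localization.Away f) (Localization.AtPrime p) :=
    IsLocalization.localizationAlgebraOfSubmonoidLe _ _ _ _ hle'
  have : IsScalarTower S (Localization.Away f) (Localization.AtPrime p) :=
    IsLocalization.localization_isScalarTower_of_submonoid_le _ _ _ _ hle'
  have : IsLocalization (p.primeCompl.map (algebraMap S (Localization.Away f)))
      (Localization.AtPrime p) :=
    IsLocalization.isLocalization_of_submonoid_le _ _ _ _ hle'
  refine isIntegrallyClosed_of_isLocalization (R := Localization.Away f) _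
    (p.primeCompl.map (algebraMap S (Localization.Away f))) ?_
  exact map_le_nonZeroDivisors_of_injective _ (IsLocalization.injective _ hle)
    p.primeCompl_le_nonZeroDivisors

lemma isIntegrallyClosed_section {X : Scheme.{u}} [IsIntegral X] {k : Type u} [Field k]
    (s : X ⟶ Spec (.of k)) [Smooth s] {U : X.Opens} (hU : IsAffineOpen U) [Nonempty U] :
    IsIntegrallyClosed Γ(X, U) := by
  have h : (s.appLE ⊤ U le_top).hom.Smooth :=
    HasRingHomProperty.appLE @Smooth s ‹_› ⟨⊤, isAffineOpen_top _⟩ ⟨U, hU⟩ le_top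
  have h2 : ((s.appLE ⊤ U le_top).hom.comp (Scheme.ΓSpecIso (.of k)).inv.hom).Smooth :=
    RingHom.Smooth.respectsIso.2 _ (Scheme.ΓSpecIso (.of k)).symm.commRingCatIsoToRingEquiv h
  let _ : Algebra k Γ(X, U) := RingHom.toAlgebra
    ((s.appLE ⊤ U le_top).hom.comp (Scheme.ΓSpecIso (.of k)).inv.hom)
  have : Algebra.Smooth k Γ(X, U) := h2
  exact isIntegrallyClosed_of_smooth k Γ(X, U)

lemma isIntegrallyClosed_stalk {X : Scheme.{u}} [IsIntegral X] {k : Type u} [Field k]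
    (s : X ⟶ Spec (.of k)) [Smooth s] (x : X) : IsIntegrallyClosed (X.presheaf.stalk x) := by
  obtain ⟨_, ⟨U, hU, rfl⟩, hxU, -⟩ :=
    X.isBasis_affineOpens.exists_subset_of_mem_open (Set.mem_univ x) isOpen_univ
  have : Nonempty U := ⟨⟨x, hxU⟩⟩
  have := isIntegrallyClosed_section s hU
  have := hU.isLocalization_stalk ⟨x, hxU⟩
  let _ := (X.presheaf.germ U x hxU).hom.toAlgebra
  exact isIntegrallyClosed_of_isLocalization (R := Γ(X, U)) _
    (hU.primeIdealOf ⟨x, hxU⟩).asIdeal.primeCompl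
    (hU.primeIdealOf ⟨x, hxU⟩).asIdeal.primeCompl_le_nonZeroDivisors

end normal

/-! ### Vanishing of a torsion-free sheaf on one chart -/

section quasicoherent
variable {X : Scheme.{u}} (M : X.Modules) {U : X.Opens}

lemma isLocalizedModule_restrict_fromSpec [M.IsQuasicoherent] (hU : IsAffineOpen U)
    (f : Γ(X, U)) :
    IsLocalizedModule (.powers f) ((modulesSpecToSheaf.obj (M.restrict hU.fromSpec)).obj.map
      (PrimeSpectrum.basicOpen f).leTop.op).hom := by
  have : IsIso (M.restrict hU.fromSpec).fromTildeΓ := inferInstance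
  exact (isIso_fromTildeΓ_iff_isLocalizing _).mp this f

lemma subsingleton_basicOpen [M.IsQuasicoherent] (hU : IsAffineOpen U) (f : Γ(X, U))
    (h : Subsingleton Γ(M, U)) : Subsingleton Γ(M, X.basicOpen f) := by
  have key := isLocalizedModule_restrict_fromSpec M hU f
  have e1 : hU.fromSpec ''ᵁ ⊤ = U := by rw [Scheme.Hom.image_top_eq_opensRange, hU.opensRange_fromSpec]
  have e2 : hU.fromSpec ''ᵁ (PrimeSpectrum.basicOpen f) = X.basicOpen f :=
    hU.fromSpec_image_basicOpen f
  have h1 : Subsingleton Γ(M.restrict hU.fromSpec, ⊤) := by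
    change Subsingleton Γ(M, hU.fromSpec ''ᵁ ⊤)
    rwa [e1]
  have h2 : Subsingleton Γ(M.restrict hU.fromSpec, PrimeSpectrum.basicOpen f) := by
    refine ⟨fun s t => ?_⟩
    have (s : Γ(M.restrict hU.fromSpec, PrimeSpectrum.basicOpen f)) : s = 0 := by
      obtain ⟨⟨m, c⟩, hm⟩ := key.surj s
      have hm0 : m = 0 := h1.elim m 0
      have hc := key.map_units c
      rw [Module.End.isUnit_iff] at hc
      refine hc.injective ((hm.trans ?_).trans (LinearMap.map_zero _).symm)
      exact (congrArg _ hm0).trans (LinearMap.map_zero _)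
    rw [this s, this t]
  change Subsingleton Γ(M, hU.fromSpec ''ᵁ _) at h2
  rwa [e2] at h2

/-- By quasi-coherence a section over `U` that vanishes on `D(f)` is killed by a power of `f`, so it
is zero by torsion-freeness. -/
lemma subsingleton_of_basicOpen [IsIntegral X] (hM : IsTorsionFreeCoherent M)
    (hU : IsAffineOpen U) (f : Γ(X, U)) (hf : f ≠ 0) (h : Subsingleton Γ(M, X.basicOpen f)) :
    Subsingleton Γ(M, U) := by
  have := hM.isQuasicoherent
  have key := isLocalizedModule_restrict_fromSpec M hU f
  have e1 : hU.fromSpec ''ᵁ ⊤ = U := by rw [Scheme.Hom.image_top_eq_opensRange, hU.opensRange_fromSpec]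
  have e2 : hU.fromSpec ''ᵁ (PrimeSpectrum.basicOpen f) = X.basicOpen f :=
    hU.fromSpec_image_basicOpen f
  have h2 : Subsingleton Γ(M.restrict hU.fromSpec, PrimeSpectrum.basicOpen f) := by
    change Subsingleton Γ(M, hU.fromSpec ''ᵁ _)
    rwa [e2]
  have h1 : Subsingleton Γ(M.restrict hU.fromSpec, ⊤) := by
    refine ⟨fun s t => ?_⟩
    -- The scalar acting on sections of the restricted module is `f ^ n` transported through these
    -- identifications; injectivity keeps it nonzero.
    have hinj : Function.Injective (fun r : Γ(X, U) => (hU.fromSpec.appIso ⊤).inv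
        ((Spec Γ(X, U)).presheaf.map (Opens.leTop ⊤).op ((Scheme.ΓSpecIso Γ(X, U)).inv r))) := by
      have : Opens.leTop (⊤ : (Spec Γ(X, U)).Opens) = 𝟙 _ := Subsingleton.elim _ _
      rw [this]
      simp only [op_id, CategoryTheory.Functor.map_id, CommRingCat.id_apply]
      exact ((ConcreteCategory.bijective_of_isIso (hU.fromSpec.appIso ⊤).inv).1.comp
        (ConcreteCategory.bijective_of_isIso (Scheme.ΓSpecIso Γ(X, U)).inv).1)
    have (s : Γ(M.restrict hU.fromSpec, ⊤)) : s = 0 := by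
      obtain ⟨⟨_, n, rfl⟩, hc⟩ := (IsLocalizedModule.eq_zero_iff (.powers f)
        ((modulesSpecToSheaf.obj (M.restrict hU.fromSpec)).obj.map
          (PrimeSpectrum.basicOpen f).leTop.op).hom (m := s)).mp (h2.elim _ 0)
      have hU' : Nonempty U := by
        by_contra hne
        apply hf
        have : IsEmpty U := not_nonempty_iff.mp hne
        obtain rfl : U = ⊥ := by ext x; exact ⟨fun hx => (this.false ⟨x, hx⟩).elim, fun hx => hx.elim⟩
        exact Subsingleton.elim _ _
      have hne : Nonempty (hU.fromSpec ''ᵁ ⊤) := by rwa [e1]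
      refine hM.torsionFree (hU.fromSpec ''ᵁ ⊤) _ s ?_ hc
      intro h0
      refine pow_ne_zero n hf (hinj (h0.trans ?_))
      simp
    rw [this s, this t]
  change Subsingleton Γ(M, hU.fromSpec ''ᵁ ⊤) at h1
  rwa [e1] at h1

end quasicoherent

section
lemma app_ne_zero_of_mem_basicOpen {X Y : Scheme.{u}} (π : X ⟶ Y) [Surjective π] {U : Y.Opens} (f : Γ(Y, U)) {y : Y} (hy : y ∈ Y.basicOpen f) :
    π.app U f ≠ 0 := by
  intro h
  obtain ⟨x, rfl⟩ := π.surjective y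
  have hx : x ∈ π ⁻¹ᵁ (Y.basicOpen f) := hy
  rw [Scheme.preimage_basicOpen, h, Scheme.basicOpen_zero] at hx
  exact hx

variable {X Y : Scheme.{u}} [IsIntegral X] [IsIntegral Y] (π : X ⟶ Y) [IsAffineHom π] [Surjective π]

/-- Two nonempty affine opens of the irreducible `Y` share a nonempty basic open; vanishing passes
down to it by localization and up again by torsion-freeness. -/
lemma subsingleton_preimage_of_subsingleton_preimage {M : X.Modules} (hM : IsTorsionFreeCoherent M)
    {U W : Y.Opens} (hU : IsAffineOpen U) (hW : IsAffineOpen W) [Nonempty U]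
    (h : Subsingleton Γ(M, π ⁻¹ᵁ U)) : Subsingleton Γ(M, π ⁻¹ᵁ W) := by
  have := hM.isQuasicoherent
  by_cases hW' : Nonempty W
  · obtain ⟨y, hyU, hyW⟩ := nonempty_preirreducible_inter U.isOpen W.isOpen
      (Set.nonempty_coe_sort.mp ‹Nonempty U›) (Set.nonempty_coe_sort.mp hW')
    obtain ⟨f, g, hfg, hy⟩ := exists_basicOpen_le_affine_inter hU hW y ⟨hyU, hyW⟩
    have h1 := subsingleton_basicOpen M (hU.preimage π) (π.app U f) h
    rw [← Scheme.preimage_basicOpen, hfg, Scheme.preimage_basicOpen] at h1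
    exact subsingleton_of_basicOpen M hM (hW.preimage π) (π.app W g)
      (app_ne_zero_of_mem_basicOpen π g (hfg ▸ hy)) h1
  · have : IsEmpty W := not_nonempty_iff.mp hW'
    obtain rfl : W = ⊥ := by ext x; exact ⟨fun hx => (this.false ⟨x, hx⟩).elim, fun hx => hx.elim⟩
    have : Subsingleton Γ(X, π ⁻¹ᵁ ⊥) := inferInstanceAs (Subsingleton Γ(X, ⊥))
    exact Module.subsingleton Γ(X, π ⁻¹ᵁ ⊥) _

lemma pushforward_hom_eq_of_subsingleton {M : X.Modules} (hM : IsTorsionFreeCoherent M)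
    {V : Y.Modules} (hV : IsVectorBundle V) (i : Chart V) [Nonempty i.U]
    (h : Subsingleton Γ(M, π ⁻¹ᵁ i.U)) {E : Y.Modules}
    (f g : (Scheme.Modules.pushforward π).obj M ⟶ E) : f = g := by
  have key (j : Chart V) : Subsingleton Γ((Scheme.Modules.pushforward π).obj M, j.U) :=
    subsingleton_preimage_of_subsingleton_preimage π hM i.isAffine j.isAffine h
  have hz (W : Y.Opens) (s : Γ((Scheme.Modules.pushforward π).obj M, W)) : s = 0 := by
    refine TopCat.Sheaf.eq_of_locally_eq' ⟨_, ((Scheme.Modules.pushforward π).obj M).isSheaf⟩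
      (fun j : {j : Chart V // j.U ≤ W} => j.1.U) W (fun j => homOfLE j.2) ?_ _ _
      (fun j => (key j.1).elim _ _)
    intro y hy
    obtain ⟨_, ⟨j, rfl⟩, hyj, hjW⟩ := Opens.isBasis_iff_nbhd.mp (chart_isBasis hV) hy
    exact Opens.mem_iSup.mpr ⟨⟨j, hjW⟩, hyj⟩
  ext W s
  rw [hz _ s, map_zero, map_zero]
end

/-! ### The morphism from `X` to `Tot(V)` given by `σ` -/

lemma functor_map_cover_f {S : Scheme.{u}} {𝒰 : S.OpenCover} [Category 𝒰.I₀] [𝒰.LocallyDirected]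
    [Small.{u} 𝒰.I₀] [Quiver.IsThin 𝒰.I₀] (d : 𝒰.RelativeGluingData) {i j : 𝒰.I₀} (f : i ⟶ j) :
    d.functor.map f ≫ d.cover.f j = d.cover.f i :=
  colimit.w d.functor f

section opens
variable {X Y : Scheme.{u}} (π : X ⟶ Y) {V : Y.Modules} (hV : IsVectorBundle V)

/-- The open cover of `X` by the preimages of the charts. -/
def preimageCover : X.OpenCover where
  I₀ := Chart V
  X i := (π ⁻¹ᵁ i.U : X.Opens)
  f i := (π ⁻¹ᵁ i.U).ι
  mem₀ := by
    rw [Scheme.presieve₀_mem_precoverage_iff]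
    refine ⟨fun x => ?_, inferInstance⟩
    obtain ⟨_, ⟨i, rfl⟩, hy, -⟩ := Opens.isBasis_iff_nbhd.mp (chart_isBasis hV)
      (show π x ∈ (⊤ : Opens Y) from trivial)
    exact ⟨i, ⟨x, hy⟩, rfl⟩

instance : Preorder (preimageCover π hV).I₀ := inferInstanceAs (Preorder (Chart V))

instance : (preimageCover π hV).LocallyDirected where
  trans {i j} h := X.homOfLE (π.preimage_mono (Chart.le (i := i) (j := j) h.le))
  trans_id i := X.homOfLE_rfl _
  trans_comp _ _ := (X.homOfLE_homOfLE _ _).symm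
  w {i j} h := X.homOfLE_ι _
  directed {i j} x := by
    let p : X := (pullback.fst ((preimageCover π hV).f i) ((preimageCover π hV).f j) ≫
      (preimageCover π hV).f i) x
    have hi : π p ∈ (i : Chart V).U :=
      (pullback.fst ((preimageCover π hV).f i) ((preimageCover π hV).f j) x).2
    have hj : π p ∈ (j : Chart V).U := by
      have : p = (pullback.snd ((preimageCover π hV).f i) ((preimageCover π hV).f j) ≫
        (preimageCover π hV).f j) x := by rw [← pullback.condition]
      rw [this]
      exact (pullback.snd ((preimageCover π hV).f i) ((preimageCover π hV).f j) x).2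
    obtain ⟨_, ⟨k, rfl⟩, hk, hle⟩ := Opens.isBasis_iff_nbhd.mp (chart_isBasis hV)
      (show π p ∈ (i : Chart V).U ⊓ (j : Chart V).U from ⟨hi, hj⟩)
    have hki : k ≤ (i : Chart V) := hle.trans inf_le_left
    have hkj : k ≤ (j : Chart V) := hle.trans inf_le_right
    refine ⟨k, homOfLE hki, homOfLE hkj, ⟨p, hk⟩, ?_⟩
    apply (pullback.fst ((preimageCover π hV).f i) ((preimageCover π hV).f j) ≫
      (preimageCover π hV).f i).isOpenEmbedding.injective
    have key (w) : pullback.lift (X.homOfLE (π.preimage_mono (Chart.le hki)) :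
        (preimageCover π hV).X k ⟶ (preimageCover π hV).X i)
        (X.homOfLE (π.preimage_mono (Chart.le hkj)) :
        (preimageCover π hV).X k ⟶ (preimageCover π hV).X j) w ≫
        pullback.fst ((preimageCover π hV).f i) ((preimageCover π hV).f j) ≫
        (preimageCover π hV).f i = (π ⁻¹ᵁ k.U).ι :=
      (pullback.lift_fst_assoc _ _ w _).trans (X.homOfLE_ι _)
    exact congr($(key _) ⟨p, hk⟩)
  property_trans {i j} h := inferInstanceAs (IsOpenImmersion (X.homOfLE _))

lemma chart_map_transRing {i j : Chart V} (h : i ≤ j) :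
    Spec.map (CommRingCat.ofHom (transRing h)) ≫ Tot.chart hV j = Tot.chart hV i :=
  functor_map_cover_f (totGluing V hV) (homOfLE h : i ⟶ j)

variable (σ : Γ((Scheme.Modules.pullback π).obj V, ⊤))

/-- The homomorphism from the coordinate ring of a chart of `Tot(V)` given by the section `σ`. -/
def coordHom (i : Chart V) : i.ring →+* Γ(X, π ⁻¹ᵁ i.U) :=
  MvPolynomial.eval₂Hom (π.app i.U).hom (sectionCoord π σ i)

lemma coordHom_transRing {i j : Chart V} (h : i ≤ j) :
    (coordHom π σ i).comp (transRing h) =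
      (X.presheaf.map (homOfLE (π.preimage_mono (Chart.le h))).op).hom.comp (coordHom π σ j) := by
  apply MvPolynomial.ringHom_ext
  · intro r
    simp only [coordHom, RingHom.comp_apply, transRing_C, MvPolynomial.coe_eval₂Hom,
      MvPolynomial.eval₂_C]
    exact app_presheaf_map π (Chart.le h) r
  · intro b
    simp only [coordHom, RingHom.comp_apply, transRing_X, MvPolynomial.coe_eval₂Hom,
      MvPolynomial.eval₂_X, MvPolynomial.eval₂_sum, MvPolynomial.eval₂_mul, MvPolynomial.eval₂_C]
    exact (sectionCoord_trans π σ h b).symm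

/-- The morphism to `Tot(V)` given by `σ`, over a chart. -/
def toTotLocal (i : Chart V) : ↑(π ⁻¹ᵁ i.U) ⟶ Tot V hV :=
  (π ⁻¹ᵁ i.U).toSpecΓ ≫ Spec.map (CommRingCat.ofHom (coordHom π σ i)) ≫ Tot.chart hV i

lemma homOfLE_toTotLocal {i j : Chart V} (h : i ≤ j) :
    X.homOfLE (π.preimage_mono (Chart.le h)) ≫ toTotLocal π hV σ j = toTotLocal π hV σ i := by
  have h1 := Scheme.Opens.toSpecΓ_SpecMap_presheaf_map _ _ (π.preimage_mono (Chart.le h))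
  have h2 := congrArg (fun f => Spec.map (CommRingCat.ofHom f)) (coordHom_transRing π σ h)
  simp only [CommRingCat.ofHom_comp, Spec.map_comp, CommRingCat.ofHom_hom] at h2
  unfold toTotLocal
  rw [← reassoc_of% h1, ← chart_map_transRing hV h, reassoc_of% h2]

/-- The morphism `X ⟶ Tot(V)` given by a section `σ` of `π^* V`. -/
def toTot : X ⟶ Tot V hV :=
  (preimageCover π hV).glueMorphismsOfLocallyDirected (fun i => toTotLocal π hV σ i)
    (fun {i j} h => homOfLE_toTotLocal π hV σ (i := i) (j := j) h.le)

lemma ι_toTot (i : Chart V) : (π ⁻¹ᵁ i.U).ι ≫ toTot π hV σ = toTotLocal π hV σ i :=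
  (preimageCover π hV).map_glueMorphismsOfLocallyDirected
    (fun i => toTotLocal π hV σ i)
    (fun {i j} h => homOfLE_toTotLocal π hV σ (i := i) (j := j) h.le) i

lemma fromSpec_toTot [IsAffineHom π] (i : Chart V) :
    (i.isAffine.preimage π).fromSpec ≫ toTot π hV σ =
      Spec.map (CommRingCat.ofHom (coordHom π σ i)) ≫ Tot.chart hV i := by
  have h := ι_toTot π hV σ i
  rw [← (i.isAffine.preimage π).isoSpec_inv_ι, Category.assoc, h]
  exact (i.isAffine.preimage π).isoSpec.inv_hom_id_assoc _

lemma fromSpec_toTot_proj [IsAffineHom π] (i : Chart V) :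
    (i.isAffine.preimage π).fromSpec ≫ toTot π hV σ ≫ Tot.proj V hV =
      (i.isAffine.preimage π).fromSpec ≫ π := by
  have h2 : (coordHom π σ i).comp MvPolynomial.C =
      (π.appLE i.U (π ⁻¹ᵁ i.U) le_rfl).hom := by
    ext r
    simp [coordHom, Scheme.Hom.app_eq_appLE]
  rw [reassoc_of% fromSpec_toTot π hV σ i, Tot.chart_proj, ← Spec.map_comp_assoc,
    ← CommRingCat.ofHom_comp, h2, CommRingCat.ofHom_hom, IsAffineOpen.SpecMap_appLE_fromSpec]

lemma toTot_proj [IsAffineHom π] : toTot π hV σ ≫ Tot.proj V hV = π := by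
  refine (preimageCover π hV).hom_ext _ _ fun (i : Chart V) => ?_
  have h1 := (i.isAffine.preimage π).isoSpec_hom_fromSpec
  change (π ⁻¹ᵁ i.U).ι ≫ _ = (π ⁻¹ᵁ i.U).ι ≫ _
  rw [← h1, Category.assoc, Category.assoc, fromSpec_toTot_proj]

end opens

/-- Reads off the effect of `f` on functions of an affine chart from the ring map `φ`. Both sides
are compared on `Spec Γ(X, W)`, where pullback is an isomorphism because `f⁻¹(j(⊤))` is all of `W`.
-/
lemma app_appIso_inv {X T : Scheme.{u}} {R : CommRingCat.{u}} {W : X.Opens}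
    (hW : IsAffineOpen W) (f : X ⟶ T) (j : Spec R ⟶ T) [IsOpenImmersion j] (φ : R ⟶ Γ(X, W))
    (h : hW.fromSpec ≫ f = Spec.map φ ≫ j) (hg : f ⁻¹ᵁ (j ''ᵁ ⊤) ≤ W) (r : R) :
    f.app (j ''ᵁ ⊤) ((j.appIso ⊤).inv ((Scheme.ΓSpecIso R).inv r)) =
      X.presheaf.map (homOfLE hg).op (φ r) := by
  let g := hW.fromSpec
  have e1 : (⊤ : (Spec R).Opens) ≤ j ⁻¹ᵁ (j ''ᵁ ⊤) := by rw [j.preimage_image_eq]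
  have e2 : (⊤ : (Spec Γ(X, W)).Opens) ≤ g ⁻¹ᵁ (f ⁻¹ᵁ (j ''ᵁ ⊤)) := by
    rw [← Scheme.Hom.comp_preimage, h, Scheme.Hom.comp_preimage, j.preimage_image_eq]
    exact le_rfl
  have e3 : (⊤ : (Spec Γ(X, W)).Opens) ≤ (Spec.map φ) ⁻¹ᵁ ⊤ := le_rfl
  have e4 : (⊤ : (Spec Γ(X, W)).Opens) ≤ g ⁻¹ᵁ W := hW.fromSpec_preimage_self.ge
  have : IsIso (homOfLE e2) := ⟨homOfLE le_top, Subsingleton.elim _ _, Subsingleton.elim _ _⟩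
  have h1 : IsIso (g.app (f ⁻¹ᵁ (j ''ᵁ ⊤))) := g.isIso_app _ (by rwa [hW.opensRange_fromSpec])
  have h2 : IsIso (g.appLE _ _ e2) := by
    unfold Scheme.Hom.appLE
    infer_instance
  have key : f.app (j ''ᵁ ⊤) ≫ g.appLE _ _ e2 = j.appLE _ _ e1 ≫ (Spec.map φ).appLE _ _ e3 := by
    rw [Scheme.Hom.appLE_comp_appLE, Scheme.Hom.app_eq_appLE, Scheme.Hom.appLE_comp_appLE]
    simp only [g, h]
  have key2 : (Scheme.ΓSpecIso R).inv ≫ (j.appIso ⊤).inv ≫ f.app (j ''ᵁ ⊤) ≫ g.appLE _ _ e2 =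
      φ ≫ (Scheme.ΓSpecIso Γ(X, W)).inv := by
    rw [key, Scheme.Hom.appIso_inv_appLE_assoc]
    have : homOfLE (show (⊤ : (Spec R).Opens) ≤ ⊤ from le_rfl) = 𝟙 _ := Subsingleton.elim _ _
    rw [this, op_id, CategoryTheory.Functor.map_id, Category.id_comp,
      Scheme.ΓSpecIso_inv_naturality]
    exact congrArg _ (Scheme.Hom.app_eq_appLE (f := Spec.map φ) (U := ⊤)).symm
  have key3 : φ ≫ X.presheaf.map (homOfLE hg).op ≫ g.appLE _ _ e2 =
      φ ≫ (Scheme.ΓSpecIso Γ(X, W)).inv := by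
    congr 1
    rw [Scheme.Hom.map_appLE, Scheme.Hom.appLE, hW.fromSpec_app_self, Category.assoc,
      ← CategoryTheory.Functor.map_comp]
    refine (congrArg _ ?_).trans (Category.comp_id _)
    exact (congrArg _ (Subsingleton.elim _ _)).trans (CategoryTheory.Functor.map_id _ _)
  exact (ConcreteCategory.bijective_of_isIso (g.appLE _ _ e2)).1
    (congr(($(key2.trans key3.symm)).hom r))

lemma mem_range_cover_f {S : Scheme.{u}} {𝒰 : S.OpenCover} [Category 𝒰.I₀] [𝒰.LocallyDirected]
    [Small.{u} 𝒰.I₀] [Quiver.IsThin 𝒰.I₀] (d : 𝒰.RelativeGluingData) (i : 𝒰.I₀) {t : d.glued}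
    (h : d.toBase t ∈ Set.range (𝒰.f i)) : t ∈ Set.range (d.cover.f i) :=
  (d.preimage_toBase_eq_range_ι i).le h

section
variable {X Y : Scheme.{u}} {V : Y.Modules} (hV : IsVectorBundle V)

lemma proj_mem_of_mem_chartOpen {i : Chart V} {t : Tot V hV} (h : t ∈ (Tot.chartOpen hV i).1) :
    Tot.proj V hV t ∈ i.U := by
  obtain ⟨x, -, rfl⟩ := h
  change Tot.proj V hV (Tot.chart hV i x) ∈ i.U
  rw [← Scheme.Hom.comp_apply, Tot.chart_proj, Scheme.Hom.comp_apply]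
  have := i.isAffine.range_fromSpec
  exact this.le ⟨_, rfl⟩

lemma mem_chartOpen_of_proj_mem {i : Chart V} {t : Tot V hV} (h : Tot.proj V hV t ∈ i.U) :
    t ∈ (Tot.chartOpen hV i).1 := by
  obtain ⟨x, hx⟩ := mem_range_cover_f (totGluing V hV) i (t := t) ⟨⟨_, h⟩, rfl⟩
  exact ⟨x, trivial, hx⟩

instance isAffineHom_proj : IsAffineHom (Tot.proj V hV) := by
  refine isAffineHom_of_forall_exists_isAffineOpen _ fun y => ?_
  obtain ⟨_, ⟨i, rfl⟩, hy, -⟩ := Opens.isBasis_iff_nbhd.mp (chart_isBasis hV)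
    (show y ∈ (⊤ : Opens Y) from trivial)
  have : Tot.proj V hV ⁻¹ᵁ i.U = (Tot.chartOpen hV i).1 :=
    le_antisymm (fun _ h => mem_chartOpen_of_proj_mem hV h)
      (fun _ h => proj_mem_of_mem_chartOpen hV h)
  exact ⟨i.U, hy, i.isAffine, this ▸ (Tot.chartOpen hV i).2⟩

lemma chartSection_bijective (i : Chart V) : Function.Bijective (Tot.chartSection hV i) :=
  ConcreteCategory.bijective_of_isIso
    ((Scheme.ΓSpecIso (.of i.ring)).inv ≫ ((Tot.chart hV i).appIso ⊤).inv)

variable (π : X ⟶ Y) [IsAffineHom π] (σ : Γ((Scheme.Modules.pullback π).obj V, ⊤))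

lemma toTot_preimage_chartOpen (i : Chart V) :
    toTot π hV σ ⁻¹ᵁ (Tot.chartOpen hV i).1 = π ⁻¹ᵁ i.U := by
  ext x
  have h : Tot.proj V hV (toTot π hV σ x) = π x := by
    rw [← Scheme.Hom.comp_apply, toTot_proj]
  exact ⟨fun hx => show π x ∈ i.U from h ▸ proj_mem_of_mem_chartOpen hV hx,
    fun hx => mem_chartOpen_of_proj_mem hV (h.symm ▸ hx)⟩

lemma toTot_app_chartSection (i : Chart V) (r : i.ring) :
    (toTot π hV σ).app (Tot.chartOpen hV i).1 (Tot.chartSection hV i r) =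
      X.presheaf.map (homOfLE (toTot_preimage_chartOpen hV π σ i).le).op (coordHom π σ i r) :=
  app_appIso_inv (i.isAffine.preimage π) (toTot π hV σ) (Tot.chart hV i)
    (CommRingCat.ofHom (coordHom π σ i)) (fromSpec_toTot π hV σ i) _ r

lemma toTot_app_chartSection_eq_zero_iff (i : Chart V) (r : i.ring) :
    (toTot π hV σ).app (Tot.chartOpen hV i).1 (Tot.chartSection hV i r) = 0 ↔
      coordHom π σ i r = 0 := by
  rw [toTot_app_chartSection]
  have h := toTot_preimage_chartOpen hV π σ i
  have : IsIso (homOfLE h.le) := ⟨homOfLE h.ge, Subsingleton.elim _ _, Subsingleton.elim _ _⟩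
  exact map_eq_zero_iff (X.presheaf.map (homOfLE h.le).op).hom
    (ConcreteCategory.bijective_of_isIso _).1

instance isAffineHom_toTot : IsAffineHom (toTot π hV σ) := by
  have : IsAffineHom (toTot π hV σ ≫ Tot.proj V hV) := by rwa [toTot_proj]
  exact IsAffineHom.of_comp _ (Tot.proj V hV)

/-- The preimage of the chart is exactly `π⁻¹U`, so on this chart the morphism is the ring map
`coordHom`. Comparing ideal sheaves thereby becomes comparing ideals of polynomials. -/
lemma ker_toTot_ideal (i : Chart V) :
    (toTot π hV σ).ker.ideal (Tot.chartOpen hV i) =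
      (RingHom.ker (coordHom π σ i)).map (Tot.chartSection hV i) := by
  rw [Scheme.Hom.ker_apply]
  ext x
  obtain ⟨r, rfl⟩ := (chartSection_bijective hV i).2 x
  rw [Ideal.mem_map_iff_of_surjective _ (chartSection_bijective hV i).2]
  constructor
  · intro h
    exact ⟨r, (toTot_app_chartSection_eq_zero_iff hV π σ i r).mp h, rfl⟩
  · rintro ⟨r', h, h'⟩
    exact h' ▸ (toTot_app_chartSection_eq_zero_iff hV π σ i r').mpr h

end

/-! ### The spectral cover as the closed image of `X`, up to nilpotents -/

section
variable {X Y : Scheme.{u}} [IsIntegral Y] (π : X ⟶ Y) [Surjective π]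

lemma app_injective {U : Y.Opens} : Function.Injective (π.app U) := by
  refine (injective_iff_map_eq_zero (π.app U).hom).mpr fun a ha => ?_
  by_contra hne
  have : Y.basicOpen a ≠ ⊥ := fun h => hne (basicOpen_eq_bot_iff a |>.mp h)
  obtain ⟨y, hy⟩ := (Opens.ne_bot_iff_nonempty _).mp this
  exact app_ne_zero_of_mem_basicOpen π a hy ha
end

section
variable {X Y : Scheme.{u}} (π : X ⟶ Y) (M : X.Modules) (U : Y.Opens)

/-- Sections over the preimage of `U` form an algebra over the sections over `U`. -/
@[reducible] def appAlgebra : Algebra Γ(Y, U) Γ(X, π ⁻¹ᵁ U) := (π.app U).hom.toAlgebra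

attribute [local instance] appAlgebra

/-- The action of functions on the sections of a pushforward. -/
def mulAlgHom : Γ(X, π ⁻¹ᵁ U) →ₐ[Γ(Y, U)]
    Module.End Γ(Y, U) Γ((Scheme.Modules.pushforward π).obj M, U) where
  toFun := mulEnd π M
  map_one' := LinearMap.ext fun m => one_smul Γ(X, π ⁻¹ᵁ U) (pushEquiv π M U m)
  map_mul' b c := LinearMap.ext fun m => mul_smul b c (pushEquiv π M U m)
  map_zero' := LinearMap.ext fun m => zero_smul Γ(X, π ⁻¹ᵁ U) (pushEquiv π M U m)
  map_add' b c := LinearMap.ext fun m => add_smul b c (pushEquiv π M U m)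
  commutes' _ := rfl

variable {M U}

lemma module_finite_pushforward [IsFinite π] (hM : IsTorsionFreeCoherent M) (hU : IsAffineOpen U) :
    Module.Finite Γ(Y, U) Γ((Scheme.Modules.pushforward π).obj M, U) := by
  let _ : Module Γ(X, π ⁻¹ᵁ U) Γ((Scheme.Modules.pushforward π).obj M, U) :=
    inferInstanceAs (Module Γ(X, π ⁻¹ᵁ U) Γ(M, π ⁻¹ᵁ U))
  have : IsScalarTower Γ(Y, U) Γ(X, π ⁻¹ᵁ U) Γ((Scheme.Modules.pushforward π).obj M, U) :=
    ⟨fun a b m => mul_smul (π.app U a) b (pushEquiv π M U m)⟩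
  have : Module.Finite Γ(X, π ⁻¹ᵁ U) Γ((Scheme.Modules.pushforward π).obj M, U) :=
    hM.finite _ (hU.preimage π)
  have : Module.Finite Γ(Y, U) Γ(X, π ⁻¹ᵁ U) := IsFinite.finite_app π U hU
  exact Module.Finite.trans Γ(X, π ⁻¹ᵁ U) _

lemma nonempty_preimage [Surjective π] [Nonempty U] : Nonempty (π ⁻¹ᵁ U : X.Opens) := by
  obtain ⟨y⟩ := ‹Nonempty U›
  obtain ⟨x, hx⟩ := π.surjective y.1
  exact ⟨x, show π x ∈ U from hx ▸ y.2⟩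

variable [IsIntegral Y] [IsFinite π] [Surjective π]

/-- An element that dies in the generic fibre is killed by a nonzero function on `U`, which stays
nonzero on `X`; torsion-freeness then makes the element zero. -/
lemma finrank_generic_ne_zero (hM : IsTorsionFreeCoherent M) (hU : IsAffineOpen U) [Nonempty U]
    (hne : ¬ Subsingleton Γ(M, π ⁻¹ᵁ U)) :
    Module.finrank Y.functionField
      (Y.functionField ⊗[Γ(Y, U)] Γ((Scheme.Modules.pushforward π).obj M, U)) ≠ 0 := by
  have := module_finite_pushforward π hM hU
  have := functionField_isFractionRing_of_isAffineOpen Y U hU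
  have : Nontrivial (Y.functionField ⊗[Γ(Y, U)] Γ((Scheme.Modules.pushforward π).obj M, U)) := by
    obtain ⟨m, hm⟩ := @exists_ne _ (not_subsingleton_iff_nontrivial.mp hne) (0 : Γ(M, π ⁻¹ᵁ U))
    refine ⟨1 ⊗ₜ (pushEquiv π M U).symm m, 0, fun h => hm ?_⟩
    have hloc : IsLocalizedModule (nonZeroDivisors Γ(Y, U))
      (TensorProduct.mk Γ(Y, U) Y.functionField
        Γ((Scheme.Modules.pushforward π).obj M, U) 1) := inferInstance
    obtain ⟨c, hc⟩ := (IsLocalizedModule.eq_zero_iff (nonZeroDivisors Γ(Y, U))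
      (TensorProduct.mk Γ(Y, U) Y.functionField
        Γ((Scheme.Modules.pushforward π).obj M, U) 1)).mp h
    refine hM.torsionFree (π ⁻¹ᵁ U) (π.app U c.1) m ?_ hc
    exact (map_ne_zero_iff (π.app U).hom (app_injective π)).mpr (nonZeroDivisors.ne_zero c.2)
  exact Module.finrank_pos.ne'

end

section
variable {X T : Scheme.{u}} (f : X ⟶ T) (I : T.IdealSheafData) (h : I ≤ f.ker)

/-- The factorization of a morphism through a closed subscheme. -/
def toSubscheme : X ⟶ I.subscheme :=
  IsClosedImmersion.lift I.subschemeι f (by rwa [Scheme.IdealSheafData.ker_subschemeι])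

lemma toSubscheme_ι : toSubscheme f I h ≫ I.subschemeι = f :=
  IsClosedImmersion.lift_fac _ _ _

/-- A positive power of the kernel has the same support as the kernel, namely the closure of the
image of `f`; hence the support of `I` lies in that closure. -/
lemma isDominant_toSubscheme [QuasiCompact f] {N : ℕ} (hN : f.ker ^ (N + 1) ≤ I) :
    IsDominant (toSubscheme f I h) := by
  have h1 := Scheme.IdealSheafData.support_antitone hN
  rw [Scheme.IdealSheafData.support_pow_succ] at h1
  have h2 : (f.ker.support : Set T) = closure (Set.range f) := Scheme.Hom.support_ker _
  refine ⟨fun c => ?_⟩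
  rw [I.subschemeι.isClosedEmbedding.isInducing.closure_eq_preimage_closure_image,
    Set.mem_preimage]
  have h3 : I.subschemeι '' Set.range (toSubscheme f I h) = Set.range f := by
    rw [← Set.range_comp]
    conv_rhs => rw [← toSubscheme_ι f I h]
    rfl
  rw [h3, ← h2]
  apply h1
  exact I.range_subschemeι.le ⟨c, rfl⟩

end

section
variable {X Y : Scheme.{u}} [IsIntegral X] [IsIntegral Y] (π : X ⟶ Y) [IsFinite π] [Surjective π]
  {M : X.Modules} {V : Y.Modules} (hV : IsVectorBundle V)
  {σ : Γ((Scheme.Modules.pullback π).obj V, ⊤)}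
  {Φ : (Scheme.Modules.pushforward π).obj M ⟶ tensor ((Scheme.Modules.pushforward π).obj M) V}

attribute [local instance] appAlgebra

lemma coordHom_eq_zero_of_mem_spectralIdeal (hM : IsTorsionFreeCoherent M)
    (hΦ : IsInducedHiggsField π M V σ Φ) (i : Chart V) (hne : ¬ Subsingleton Γ(M, π ⁻¹ᵁ i.U))
    {P : i.ring} (hP : P ∈ spectralIdeal Φ i) : coordHom π σ i P = 0 := by
  suffices spectralIdeal Φ i ≤ RingHom.ker (coordHom π σ i) from this hP
  refine Ideal.span_le.mpr ?_
  rintro P ⟨hU, φ, α, hφ, h⟩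
  have := module_finite_pushforward π hM i.isAffine
  have := functionField_isFractionRing_of_isAffineOpen Y i.U i.isAffine
  have := nonempty_preimage π (U := i.U)
  have : Module.Finite Γ(Y, i.U) Γ(X, π ⁻¹ᵁ i.U) := IsFinite.finite_app π i.U i.isAffine
  obtain rfl := hφ.eq_mulEnd π hΦ
  exact aeval_eq_zero_of_map_eq_coeff_genericPencil (mulAlgHom π M i.U) Y.functionField
    (finrank_generic_ne_zero π hM i.isAffine hne) (sectionCoord π σ i) P α h

/-- The radical is the intersection of the primes containing the spectral ideal, and
`mem_of_forall_coeff_genericPencil_mem` treats each of them. -/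
lemma ker_coordHom_le_radical (hM : IsTorsionFreeCoherent M)
    (hΦ : IsInducedHiggsField π M V σ Φ) (i : Chart V)
    (hY : Nonempty i.U → IsIntegrallyClosed Γ(Y, i.U)) :
    RingHom.ker (coordHom π σ i) ≤ (spectralIdeal Φ i).radical := by
  by_cases hU : Nonempty i.U
  · have := hY hU
    have := module_finite_pushforward π hM i.isAffine
    have := functionField_isFractionRing_of_isAffineOpen Y i.U i.isAffine
    have := nonempty_preimage π (U := i.U)
    have : Module.Finite Γ(Y, i.U) Γ(X, π ⁻¹ᵁ i.U) := IsFinite.finite_app π i.U i.isAffine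
    rw [Ideal.radical_eq_sInf]
    refine le_sInf fun q hq f hf => ?_
    have := hq.2
    exact mem_of_forall_coeff_genericPencil_mem (mulAlgHom π M i.U) Y.functionField
      (sectionCoord π σ i) q (fun P α h => hq.1 (Ideal.subset_span
        ⟨hU, _, α, isComponents_mulEnd π hΦ i, h⟩)) f hf
  · have : IsEmpty i.U := not_nonempty_iff.mp hU
    have hbot : i.U = ⊥ := by
      ext x; exact ⟨fun hx => (this.false ⟨x, hx⟩).elim, fun hx => hx.elim⟩
    have : Subsingleton Γ(Y, i.U) := by rw [hbot]; infer_instance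
    exact (Subsingleton.elim (RingHom.ker (coordHom π σ i)) _).le

lemma spectralIdealSheaf_le_ker (hM : IsTorsionFreeCoherent M)
    (hΦ : IsInducedHiggsField π M V σ Φ)
    (hne : ∀ i : Chart V, Nonempty i.U → ¬ Subsingleton Γ(M, π ⁻¹ᵁ i.U)) :
    spectralIdealSheaf hV Φ ≤ (toTot π hV σ).ker := by
  refine sInf_le fun i => ?_
  rw [ker_toTot_ideal]
  refine Ideal.map_mono fun P hP => ?_
  by_cases hU : Nonempty i.U
  · exact coordHom_eq_zero_of_mem_spectralIdeal π hM hΦ i (hne i hU) hP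
  · have : IsEmpty i.U := not_nonempty_iff.mp hU
    have hbot : i.U = ⊥ := by
      ext x; exact ⟨fun hx => (this.false ⟨x, hx⟩).elim, fun hx => hx.elim⟩
    have : Subsingleton Γ(Y, i.U) := by rw [hbot]; infer_instance
    rw [Subsingleton.elim P 0]
    exact zero_mem _

/-- In a Noetherian chart some power of the kernel lies in the spectral ideal. Finitely many charts
cover `Y`, so one exponent works for all of them, and therefore for every ideal sheaf in the infimum
defining the spectral one. -/
lemma exists_ker_pow_le_spectralIdealSheaf [CompactSpace Y] [IsLocallyNoetherian Y]
    (hM : IsTorsionFreeCoherent M) (hΦ : IsInducedHiggsField π M V σ Φ)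
    (hY : ∀ i : Chart V, Nonempty i.U → IsIntegrallyClosed Γ(Y, i.U)) :
    ∃ N, (toTot π hV σ).ker ^ (N + 1) ≤ spectralIdealSheaf hV Φ := by
  have h1 (i : Chart V) : ∃ N, RingHom.ker (coordHom π σ i) ^ N ≤ spectralIdeal Φ i := by
    have : IsNoetherianRing Γ(Y, i.U) := IsLocallyNoetherian.component_noetherian ⟨i.U, i.isAffine⟩
    exact Ideal.exists_pow_le_of_le_radical_of_fg (ker_coordHom_le_radical π hM hΦ i (hY i))
      (IsNoetherian.noetherian _)
  choose N hN using h1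
  obtain ⟨t, ht⟩ := isCompact_univ.elim_finite_subcover (fun i : Chart V => (i.U : Set Y))
    (fun i => i.U.isOpen) (fun y _ => by
      obtain ⟨_, ⟨i, rfl⟩, hy, -⟩ := Opens.isBasis_iff_nbhd.mp (chart_isBasis hV)
        (show y ∈ (⊤ : Opens Y) from trivial)
      exact Set.mem_iUnion.mpr ⟨i, hy⟩)
  -- The sum serves as a common upper bound of the chartwise exponents.
  refine ⟨∑ i ∈ t, N i, le_sInf fun J hJ => ?_⟩
  refine Scheme.IdealSheafData.le_of_iSup_eq_top (fun i : t => Tot.chartOpen hV i.1) ?_ ?_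
  · refine top_le_iff.mp fun x _ => ?_
    obtain ⟨i, hi, hx⟩ := Set.mem_iUnion₂.mp (ht (Set.mem_univ (Tot.proj V hV x)))
    exact Opens.mem_iSup.mpr ⟨⟨i, hi⟩, mem_chartOpen_of_proj_mem hV hx⟩
  · intro i
    refine le_trans ?_ (hJ i.1)
    rw [Scheme.IdealSheafData.ideal_pow, Pi.pow_apply, ker_toTot_ideal, ← Ideal.map_pow]
    refine Ideal.map_mono (le_trans (Ideal.pow_le_pow_right ?_) (hN i.1))
    exact (Finset.single_le_sum (f := N) (fun _ _ => Nat.zero_le _) i.2).trans (Nat.le_succ _)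

/-- The morphism to the spectral cover given by the section defining the Higgs field. -/
def toSpectralCover (h : spectralIdealSheaf hV Φ ≤ (toTot π hV σ).ker) : X ⟶ SpectralCover hV Φ :=
  toSubscheme (toTot π hV σ) (spectralIdealSheaf hV Φ) h

lemma toSpectralCover_proj (h : spectralIdealSheaf hV Φ ≤ (toTot π hV σ).ker) :
    toSpectralCover π hV h ≫ SpectralCover.proj hV Φ = π :=
  (Category.assoc _ _ _).symm.trans ((congrArg (· ≫ Tot.proj V hV)
    (toSubscheme_ι (toTot π hV σ) (spectralIdealSheaf hV Φ) h)).trans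
    (toTot_proj π hV σ))

instance : IsSeparated (SpectralCover.proj hV Φ) :=
  inferInstanceAs (IsSeparated ((spectralIdealSheaf hV Φ).subschemeι ≫ Tot.proj V hV))

/-- The composite with the separated projection to `Y` is the finite morphism `π`. -/
lemma isIntegralHom_toSpectralCover (h : spectralIdealSheaf hV Φ ≤ (toTot π hV σ).ker) :
    IsIntegralHom (toSpectralCover π hV h) := by
  have : IsIntegralHom (toSpectralCover π hV h ≫ SpectralCover.proj hV Φ) := by
    rw [toSpectralCover_proj]; infer_instance
  exact IsIntegralHom.of_comp _ (SpectralCover.proj hV Φ)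

lemma isDominant_toSpectralCover [CompactSpace Y] [IsLocallyNoetherian Y]
    (hM : IsTorsionFreeCoherent M) (hΦ : IsInducedHiggsField π M V σ Φ)
    (hY : ∀ i : Chart V, Nonempty i.U → IsIntegrallyClosed Γ(Y, i.U))
    (h : spectralIdealSheaf hV Φ ≤ (toTot π hV σ).ker) :
    IsDominant (toSpectralCover π hV h) := by
  obtain ⟨N, hN⟩ := exists_ker_pow_le_spectralIdealSheaf π hV hM hΦ hY
  exact isDominant_toSubscheme (toTot π hV σ) (spectralIdealSheaf hV Φ) h hN

end

/-! ### Function fields and birationality in prime degree -/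

lemma subring_eq_top_of_finrank_prime {F L : Type*} [CommRing F] [CommRing L] (f : F →+* L)
    (hF : IsField F) (hL : IsField L) (hp : letI := f.toAlgebra; (Module.finrank F L).Prime)
    (S : Subring L) (hS : f.range ≤ S) {x : L} (hx : x ∈ S) (hxf : x ∉ f.range) : S = ⊤ := by
  let _ := hF.toField
  let _ := hL.toField
  let _ := f.toAlgebra
  have := Subalgebra.isSimpleOrder_of_finrank_prime F L hp
  let T : Subalgebra F L := { S with algebraMap_mem' := fun a => hS ⟨a, rfl⟩ }
  rcases eq_bot_or_eq_top T with h | h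
  · exact (hxf (Algebra.mem_bot.mp (h ▸ (show x ∈ T from hx)))).elim
  · exact eq_top_iff.mpr fun y _ => (show y ∈ T from h ▸ Algebra.mem_top)

section
variable {X Y : Scheme.{u}} [IsIntegral X] [IsIntegral Y] (π : X ⟶ Y) [Surjective π]

lemma map_genericPoint : π (genericPoint X) = genericPoint Y := by
  have h := (genericPoint_spec X).image π.continuous
  rw [Set.image_univ, π.surjective.range_eq, closure_univ] at h
  exact h.eq (genericPoint_spec Y)

lemma isField_stalk_map_genericPoint : IsField (Y.presheaf.stalk (π (genericPoint X))) := by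
  rw [map_genericPoint π]
  exact Field.toIsField Y.functionField

lemma isField_stalk_genericPoint : IsField (X.presheaf.stalk (genericPoint X)) :=
  Field.toIsField X.functionField

lemma exists_germ_eq_of_isIntegralElem {U : Y.Opens} (hU : IsAffineOpen U) [Nonempty U]
    [IsIntegrallyClosed Γ(Y, U)] (y : Y) (hy : y = genericPoint Y) (hyU : y ∈ U)
    (a : Y.presheaf.stalk y) (ha : (Y.presheaf.germ U y hyU).hom.IsIntegralElem a) :
    ∃ b, Y.presheaf.germ U y hyU b = a := by
  subst hy
  have := functionField_isFractionRing_of_isAffineOpen Y U hU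
  exact IsIntegrallyClosed.isIntegral_iff (R := Γ(Y, U)) (K := Y.functionField) |>.mp ha

lemma mem_preimage_of_nonempty {U : Y.Opens} [hU : Nonempty U] : π (genericPoint X) ∈ U := by
  rw [map_genericPoint π]
  exact ((genericPoint_spec Y).mem_open_set_iff U.isOpen).mpr (by simpa using hU)

/-- Here normality of `Y` enters: `s` is integral over `Γ(Y, U)`, so the element `a` of `K(Y)` with
the same image in `K(X)` is integral too, hence a function on `U`. -/
lemma exists_app_eq_of_germ_eq_stalkMap [IsFinite π] {U : Y.Opens} (hU : IsAffineOpen U)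
    [Nonempty U] [IsIntegrallyClosed Γ(Y, U)] (s : Γ(X, π ⁻¹ᵁ U))
    (a : Y.presheaf.stalk (π (genericPoint X)))
    (h : X.presheaf.germ (π ⁻¹ᵁ U) (genericPoint X) (mem_preimage_of_nonempty π) s =
      π.stalkMap (genericPoint X) a) : ∃ b, π.app U b = s := by
  have hint : (Y.presheaf.germ U _ (mem_preimage_of_nonempty π)).hom.IsIntegralElem a := by
    obtain ⟨p, hp, hp0⟩ := (IsFinite.finite_app π U hU).to_isIntegral s
    refine ⟨p, hp, ?_⟩
    let _ := (isField_stalk_map_genericPoint π).toField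
    have := (isField_stalk_genericPoint (X := X)).nontrivial
    refine (map_eq_zero_iff (π.stalkMap (genericPoint X)).hom (RingHom.injective _)).mp ?_
    rw [Polynomial.hom_eval₂]
    have h1 : (π.stalkMap (genericPoint X)).hom.comp (Y.presheaf.germ U _ (mem_preimage_of_nonempty π)).hom =
        (X.presheaf.germ (π ⁻¹ᵁ U) (genericPoint X) (mem_preimage_of_nonempty π)).hom.comp
          (π.app U).hom :=
      congr(($(π.germ_stalkMap U (genericPoint X) (mem_preimage_of_nonempty π))).hom)
    refine (congrArg₂ (fun f x => Polynomial.eval₂ f x p) h1 h.symm).trans ?_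
    rw [← Polynomial.hom_eval₂, hp0, map_zero]
  obtain ⟨b, hb⟩ := exists_germ_eq_of_isIntegralElem hU _ (map_genericPoint π)
    (mem_preimage_of_nonempty π) a hint
  refine ⟨b, germ_injective_of_isIntegral X (genericPoint X) (mem_preimage_of_nonempty π) ?_⟩
  rw [h, ← hb]
  exact (π.germ_stalkMap_apply U (genericPoint X) _ b).symm

end

/-- Since `π` factors through `ν`, whatever comes from the stalk of `Y` already comes from the
residue field of `C`. At the generic point this puts `K(Y)` inside the subfield to be shown equal to
`K(X)`. -/
lemma range_stalkMap_le_comap_residueFieldMap {X Y C : Scheme.{u}} (ν : X ⟶ C) (p : C ⟶ Y)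
    (π : X ⟶ Y) (h : ν ≫ p = π) (x : X) :
    (π.stalkMap x).hom.range ≤ (ν.residueFieldMap x).hom.range.comap (X.residue x).hom := by
  subst h
  rintro _ ⟨a, rfl⟩
  refine ⟨p.residueFieldMap (ν x) (Y.residue _ a), ?_⟩
  have h1 := Scheme.residueFieldMap_comp ν p x
  have h2 := Scheme.residue_residueFieldMap (ν ≫ p) x
  rw [h1] at h2
  exact congr(($h2).hom a)

lemma germ_app_mem_comap_residueFieldMap {X T C : Scheme.{u}} (ν : X ⟶ C) (p : C ⟶ T)
    (f : X ⟶ T) (h : ν ≫ p = f) {O : T.Opens} (t : Γ(T, O)) (x : X) (hx : f x ∈ O) :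
    X.presheaf.germ (f ⁻¹ᵁ O) x hx (f.app O t) ∈
      (ν.residueFieldMap x).hom.range.comap (X.residue x).hom := by
  apply range_stalkMap_le_comap_residueFieldMap ν p f h x
  exact ⟨_, f.germ_stalkMap_apply O x hx t⟩

section
variable {X Y : Scheme.{u}} [IsIntegral X] [IsIntegral Y] (π : X ⟶ Y) [IsFinite π] [Surjective π]
  {M : X.Modules} {V : Y.Modules} (hV : IsVectorBundle V)
  {σ : Γ((Scheme.Modules.pullback π).obj V, ⊤)}
  {Φ : (Scheme.Modules.pushforward π).obj M ⟶ tensor ((Scheme.Modules.pushforward π).obj M) V}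

/-- The image of the residue field of `C_Φ` contains `K(Y)` and, as the pullback of a fibre
coordinate, the element `s l`, which is not in `K(Y)`. In prime degree nothing lies strictly between
`K(Y)` and `K(X)`. -/
lemma residueFieldMap_toSpectralCover_bijective (hdeg : (degree π).Prime)
    (h : spectralIdealSheaf hV Φ ≤ (toTot π hV σ).ker) (i : Chart V) [Nonempty i.U]
    [IsIntegrallyClosed Γ(Y, i.U)] (l : Fin i.n)
    (hl : ¬ ∃ b, π.app i.U b = sectionCoord π σ i l) :
    Function.Bijective ((toSpectralCover π hV h).residueFieldMap (genericPoint X)) := by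
  refine ⟨RingHom.injective ((toSpectralCover π hV h).residueFieldMap (genericPoint X)).hom, ?_⟩
  have hξ : genericPoint X ∈ π ⁻¹ᵁ i.U := mem_preimage_of_nonempty π
  have htop := subring_eq_top_of_finrank_prime (π.stalkMap (genericPoint X)).hom
    (isField_stalk_map_genericPoint π) isField_stalk_genericPoint hdeg
    (((toSpectralCover π hV h).residueFieldMap (genericPoint X)).hom.range.comap
      (X.residue (genericPoint X)).hom)
    (range_stalkMap_le_comap_residueFieldMap _ _ π (toSpectralCover_proj π hV h) _)
    (x := X.presheaf.germ (π ⁻¹ᵁ i.U) (genericPoint X) hξ (sectionCoord π σ i l)) ?_ ?_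
  · intro y
    obtain ⟨z, rfl⟩ := X.residue_surjective _ y
    exact (show z ∈ _ from htop.ge (Subring.mem_top z))
  · have h1 := germ_app_mem_comap_residueFieldMap (toSpectralCover π hV h)
      (spectralIdealSheaf hV Φ).subschemeι (toTot π hV σ)
      (toSubscheme_ι (toTot π hV σ) (spectralIdealSheaf hV Φ) h)
      (Tot.chartSection hV i (MvPolynomial.X l)) (genericPoint X)
      ((toTot_preimage_chartOpen hV π σ i).ge hξ)
    rw [toTot_app_chartSection] at h1
    have h2 : coordHom π σ i (MvPolynomial.X l) = sectionCoord π σ i l := by simp [coordHom]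
    rw [h2] at h1
    rwa [TopCat.Presheaf.germ_res_apply] at h1
  · rintro ⟨a, ha⟩
    exact hl (exists_app_eq_of_germ_eq_stalkMap π i.isAffine _ a ha.symm)

end

/-! ### Descent of `σ` to a section of `V` -/

section
variable {X Y : Scheme.{u}} [IsIntegral Y] (π : X ⟶ Y) [Surjective π] {V : Y.Modules}

lemma pullbackSection_injective (i : Chart V) {W : Y.Opens} (h : W ≤ i.U) :
    Function.Injective (pullbackSection π : Γ(V, W) → _) := by
  refine (injective_iff_map_eq_zero
    (appL ((Scheme.Modules.pullbackPushforwardAdjunction π).unit.app V) W)).mpr fun v hv => ?_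
  have hv' : pullbackSection π v = 0 := hv
  rw [← i.frame.sum_coord h v, pullbackSection_sum] at hv'
  simp only [pullbackSection_smul] at hv'
  have h0 := ((i.frame.pullback π) (π ⁻¹ᵁ W) (π.preimage_mono h)).1
    (a₁ := fun l => π.app W (i.frame.coord h v l)) (a₂ := 0) (((Finset.sum_congr rfl fun l _ =>
      congrArg (π.app W (i.frame.coord h v l) • ·) (pullbackSection_res π h (i.e l)).symm).trans hv').trans
      (Finset.sum_eq_zero fun _ _ => zero_smul _ _).symm)
  refine (i.frame.coord h).map_eq_zero_iff.mp (funext fun l => ?_)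
  exact (map_eq_zero_iff (π.app W).hom (app_injective π)).mp (congrFun h0 l)

/-- The local descents `∑ b l • e l` agree on overlaps because their pullbacks both equal `σ` there
and pullback of sections is injective for surjective `π`. -/
lemma exists_pullbackSection_eq (hV : IsVectorBundle V)
    (σ : Γ((Scheme.Modules.pullback π).obj V, ⊤))
    (h : ∀ (i : Chart V) (l : Fin i.n), ∃ b, π.app i.U b = sectionCoord π σ i l) :
    ∃ τ : Γ(V, ⊤), pullbackSection π τ = σ := by
  choose b hb using h
  have hτ (i : Chart V) : pullbackSection π (∑ l, b i l • i.e l) = res _ le_top σ := by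
    rw [pullbackSection_sum]
    simp only [pullbackSection_smul, hb]
    exact sum_sectionCoord π σ i
  have hcover : (⊤ : Y.Opens) ≤ ⨆ i : Chart V, i.U := fun y hy => by
    obtain ⟨_, ⟨i, rfl⟩, hy, -⟩ := Opens.isBasis_iff_nbhd.mp (chart_isBasis hV) hy
    exact Opens.mem_iSup.mpr ⟨i, hy⟩
  obtain ⟨τ, hτ', -⟩ := TopCat.Sheaf.existsUnique_gluing' ⟨_, V.isSheaf⟩
    (fun i : Chart V => i.U) ⊤ (fun i => homOfLE le_top) hcover (fun i => ∑ l, b i l • i.e l)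
    (fun i j => by
      apply pullbackSection_injective π i (W := i.U ⊓ j.U) inf_le_left
      refine (pullbackSection_res π inf_le_left _).trans
        (Eq.trans ?_ (pullbackSection_res π inf_le_right _).symm)
      rw [hτ, hτ, res_res, res_res])
  refine ⟨τ, ?_⟩
  refine TopCat.Sheaf.eq_of_locally_eq' ⟨_, ((Scheme.Modules.pullback π).obj V).isSheaf⟩
    (fun i : Chart V => π ⁻¹ᵁ i.U) (π ⁻¹ᵁ ⊤) (fun i => homOfLE (π.preimage_mono le_top))
    (fun x hx => ?_) _ _ fun i => ?_
  · obtain ⟨i, hi⟩ := Opens.mem_iSup.mp (hcover (show π x ∈ (⊤ : Y.Opens) from trivial))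
    exact Opens.mem_iSup.mpr ⟨i, hi⟩
  · have h1 : res V le_top τ = ∑ l, b i l • i.e l := hτ' i
    refine (pullbackSection_res π le_top τ).symm.trans ?_
    rw [h1, hτ]
    rfl
end

/-! ### Finiteness properties of projective varieties -/

instance (n : ℕ) : Algebra.FiniteType (MvPolynomial.homogeneousSubmodule (Fin (n + 1)) ℂ 0)
    (MvPolynomial (Fin (n + 1)) ℂ) :=
  have : IsScalarTower ℂ (MvPolynomial.homogeneousSubmodule (Fin (n + 1)) ℂ 0)
      (MvPolynomial (Fin (n + 1)) ℂ) := ⟨fun c a p => smul_mul_assoc c a.1 p⟩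
  Algebra.FiniteType.of_restrictScalars_finiteType ℂ _ _

lemma IsSmoothProjectiveVariety.compactSpace {X : Scheme.{0}} {s : X ⟶ Spec (.of ℂ)}
    (h : IsSmoothProjectiveVariety s) : CompactSpace X := by
  obtain ⟨n, j, hj, -⟩ := h.projective
  have h1 : QuasiCompact (Proj.toSpecZero (MvPolynomial.homogeneousSubmodule (Fin (n + 1)) ℂ)) :=
    inferInstance
  have h2 : QuasiCompact (j ≫ Proj.toSpecZero
    (MvPolynomial.homogeneousSubmodule (Fin (n + 1)) ℂ)) := MorphismProperty.comp_mem _ _ _ inferInstance h1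
  exact QuasiCompact.compactSpace_of_compactSpace (j ≫ Proj.toSpecZero
    (MvPolynomial.homogeneousSubmodule (Fin (n + 1)) ℂ))

lemma IsSmoothProjectiveVariety.isLocallyNoetherian {X : Scheme.{0}} {s : X ⟶ Spec (.of ℂ)}
    (h : IsSmoothProjectiveVariety s) : IsLocallyNoetherian X := by
  have := h.smooth
  have : IsNoetherianRing (CommRingCat.of ℂ) := inferInstanceAs (IsNoetherianRing ℂ)
  exact LocallyOfFiniteType.isLocallyNoetherian s

end HiggsCover
end

/-! ### The dichotomy -/

open CategoryTheory AlgebraicGeometry HiggsCover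

theorem mainTheorem2 {X Y : Scheme.{0}} [IsIntegral X] [IsIntegral Y]
    (sX : X ⟶ Spec (.of ℂ)) (sY : Y ⟶ Spec (.of ℂ))
    (hX : IsSmoothProjectiveVariety sX) (hY : IsSmoothProjectiveVariety sY)
    (π : X ⟶ Y) (hπ : π ≫ sY = sX) [IsFinite π] [Surjective π] (hdeg : (degree π).Prime)
    (M : X.Modules) (hM : IsTorsionFreeCoherent M)
    (V : Y.Modules) (hV : IsVectorBundle V)
    (σ : Γ((Scheme.Modules.pullback π).obj V, ⊤)) :
    (∃! Φ, IsInducedHiggsField π M V σ Φ) ∧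
    ∀ Φ, IsInducedHiggsField π M V σ Φ →
      (∃ τ : Γ(V, ⊤), Φ = tensorSection ((Scheme.Modules.pushforward π).obj M) τ) ∨
      (∃ ν : X ⟶ SpectralCover hV Φ, ν ≫ SpectralCover.proj hV Φ = π ∧ IsNormalization ν) := by
  have huniq := existsUnique_isInducedHiggsField π M hV σ
  refine ⟨huniq, fun Φ hΦ => ?_⟩
  have := hX.smooth
  have := hY.smooth
  have := hY.compactSpace
  have := hY.isLocallyNoetherian
  have hnormal (i : Chart V) (_ : Nonempty i.U) : IsIntegrallyClosed Γ(Y, i.U) :=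
    isIntegrallyClosed_section sY i.isAffine
  -- Vanishing over one nonempty chart forces `π_* M = 0`, so `τ = 0` works.
  by_cases hM0 : ∃ i : Chart V, Nonempty i.U ∧ Subsingleton Γ(M, π ⁻¹ᵁ i.U)
  · obtain ⟨i, hi, h⟩ := hM0
    exact Or.inl ⟨0, pushforward_hom_eq_of_subsingleton π hM hV i h _ _⟩
  by_cases hσ : ∀ (i : Chart V) (l : Fin i.n), ∃ b, π.app i.U b = sectionCoord π σ i l
  · obtain ⟨τ, hτ⟩ := exists_pullbackSection_eq π hV σ hσ
    exact Or.inl ⟨τ, huniq.unique hΦ (isInducedHiggsField_tensorSection π hτ)⟩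
  · push Not at hσ hM0
    obtain ⟨i, l, hl⟩ := hσ
    -- Over an empty chart the ring of functions is zero and every coordinate is trivially a
    -- pullback.
    have hi : Nonempty i.U := by
      by_contra hne
      have : IsEmpty i.U := not_nonempty_iff.mp hne
      have hbot : π ⁻¹ᵁ i.U = ⊥ := by
        ext x; exact ⟨fun hx => (this.false ⟨π x, hx⟩).elim, fun hx => hx.elim⟩
      have : Subsingleton Γ(X, π ⁻¹ᵁ i.U) := by rw [hbot]; infer_instance
      exact hl 0 (Subsingleton.elim _ _)
    have := hnormal i hi
    have h := spectralIdealSheaf_le_ker π hV hM hΦ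
      fun j hj => not_subsingleton_iff_nontrivial.mpr (hM0 j hj)
    exact Or.inr ⟨toSpectralCover π hV h, toSpectralCover_proj π hV h,
      isIntegrallyClosed_stalk sX, isIntegralHom_toSpectralCover π hV h,
      isDominant_toSpectralCover π hV hM hΦ hnormal h,
      residueFieldMap_toSpectralCover_bijective π hV hdeg h i l (by simpa using hl)⟩
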